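/- Let $\alpha\in(0,1)$ be irrational with continued fraction $\alpha=[0;a_1,a_2,\dots]$, and let $q_0=1$, $q_1=a_1$, $q_{k+1}=a_{k+1}q_k+q_{k-1}$ $(k\ge 1)$ be the denominators of its convergents. The Ostrowski representation of a positive integer $x$ with respect to $\alpha$ is the unique representation $x=\sum_{k\ge 0} b_kq_k$ with integer digits $b_k$, only finitely many of them nonzero, such that $0\le b_0\le a_1-1$, $0\le b_k\le a_{k+1}$ for $k\ge 1$, and $b_{k-1}=0$ whenever $k\ge 1$ and $b_k=a_{k+1}$. For $\theta\in[0,1)$ let $s_i=\lfloor (i+1)\alpha+\theta\rfloor-\lfloor i\alpha+\theta\rfloor$ $(i\ge 1)$ be the Sturmian word of slope $\alpha$ and intercept $\theta$. For integers $m,n\ge 1$, its $m\times n$ (Hankel) rectangles are called balanced if there is an integer $c$ such that $\sum_{k=0}^{m-1}\sum_{\ell=0}^{n-1}s_{i+k+\ell}\in\{c,c+1\}$ for all $i\ge 1$. Theorem. Let $\alpha\in(0,1)$ be irrational, $\theta\in[0,1)$, and let $2\le m\le n$ be integers. Let $m=\sum_k b_kq_k$ and $n=\sum_k d_kq_k$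 be the Ostrowski representations of $m$ and $n$ with respect to $\alpha$. Then the $m\times n$ rectangles of the Sturmian word of slope $\alpha$ and intercept $\theta$ are balanced if and only if at least one of the following holds: (i) there is $M\ge 0$ such that $b_k=0$ for all $k>M$ and $d_k=0$ for all $k\le M$, i.e. $m=\sum_{k=0}^{M}b_kq_k$ and $n=\sum_{k\ge M+1}d_kq_k$; (ii) there are $M,t\ge 0$ such that $m=\sum_{k=0}^{M}b_kq_k$ with $b_M\ne 0$, and $n=q_M+\sum_{k\ge M+1+2t}d_kq_k$ with $d_{M+1+2t}\neq 0$ (that is, $d_M=1$ and all other $d_k$ with $k<M+1+2t$ vanish); (iii) there are $M,t\ge 0$ such that $m=q_M$ and $n=\sum_{k=0}^{M-1}d_kq_k+\sum_{k\ge M+2t}d_kq_k$ with $d_{M+2t}\ne 0$; (iv) there are $M\ge 1$, $t\ge 0$ and $1\le a<a_{M+1}$ such that $m=q_{M-1}+aq_M$ and $n=\sum_{k=0}^{M-1}d_kq_k+\sum_{k\ge M+1+2t}d_kq_k$ with $d_{M+1+2t}\ne 0$. -/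

import Mathlib

/-- The partial quotients `a₀, a₁, a₂, …` of the simple continued fraction
`α = [a₀; a₁, a₂, …]` of a positive irrational number `α`, as natural numbers, read off from
Mathlib's continued fraction `GenContFract.of α` (whose sequence of partial denominators starts
with `a₁` at position `0`). -/
noncomputable def partQuot (α : ℝ) : ℕ → ℕ
  | 0 => ⌊α⌋₊
  | k + 1 => ⌊((GenContFract.of α).partDens.get? k).getD 0⌋₊

/-- The denominators `q₀, q₁, q₂, …` of the convergents of `α`. -/
noncomputable def convDen (α : ℝ) : ℕ → ℕ
  | 0 => 1
  | 1 => partQuot α 1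
  | k + 2 => partQuot α (k + 2) * convDen α (k + 1) + convDen α k

/-- For irrational `α`, `partQuot α (k + 1)` is the `k`-th entry of Mathlib's sequence of partial
denominators: no truncation takes place. -/
theorem partDens_get?_eq {α : ℝ} (hα : Irrational α) (k : ℕ) :
    (GenContFract.of α).partDens.get? k = some (partQuot α (k + 1) : ℝ) := by
  have hnt : ¬ (GenContFract.of α).TerminatedAt k := by
    intro h
    obtain ⟨r, hr⟩ := GenContFract.exists_rat_eq_of_terminates (v := α) ⟨k, h⟩
    exact hα ⟨r, hr.symm⟩
  have hne : (GenContFract.of α).partDens.get? k ≠ none := by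
    intro h
    exact hnt (GenContFract.terminatedAt_iff_partDen_none.2 h)
  obtain ⟨b, hb⟩ := Option.ne_none_iff_exists'.1 hne
  obtain ⟨z, hz⟩ := GenContFract.exists_int_eq_of_partDen hb
  have h1 : 1 ≤ b := GenContFract.of_one_le_get?_partDen hb
  have hz0 : 0 ≤ z := by
    have : (0 : ℝ) ≤ z := by rw [← hz]; linarith
    exact_mod_cast this
  obtain ⟨n, rfl⟩ := Int.eq_ofNat_of_zero_le hz0
  have hbn : b = (n : ℝ) := by simpa using hz
  subst hbn
  simp [partQuot, hb]

/-- For irrational `α`, `convDen α k` is Mathlib's denominator of the `k`-th convergent. -/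
theorem convDen_cast {α : ℝ} (hα : Irrational α) (k : ℕ) :
    (convDen α k : ℝ) = (GenContFract.of α).dens k := by
  have hs : ∀ k, (GenContFract.of α).s.get? k = some ⟨1, (partQuot α (k + 1) : ℝ)⟩ := by
    intro k
    obtain ⟨gp, hgp, hb⟩ := GenContFract.exists_s_b_of_partDen (partDens_get?_eq hα k)
    have ha := GenContFract.of_partNum_eq_one (GenContFract.partNum_eq_s_a hgp)
    rw [hgp, ← ha, ← hb]
  induction k using Nat.twoStepInduction with
  | zero => simp [convDen, GenContFract.zeroth_den_eq_one]
  | one => rw [GenContFract.first_den_eq (hs 0)]; simp [convDen]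
  | more k h0 h1 =>
    rw [GenContFract.dens_recurrence (hs (k + 1)) rfl rfl, ← h0, ← h1]
    simp [convDen]

/-- `IsOstrowski α b n`: the digits `b₀, b₁, …` (finitely many of them nonzero) form the Ostrowski
representation `n = ∑ₖ bₖ qₖ` of `n` with respect to `α`. -/
structure IsOstrowski (α : ℝ) (b : ℕ →₀ ℕ) (n : ℕ) : Prop where
  sum_eq : n = b.sum fun k d => d * convDen α k
  digit_zero : b 0 + 1 ≤ partQuot α 1
  digit_le : ∀ k, 1 ≤ k → b k ≤ partQuot α (k + 1)
  digit_rule : ∀ k, 1 ≤ k → b k = partQuot α (k + 1) → b (k - 1) = 0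

/-- The Sturmian word of slope `α` and intercept `θ` (used at indices `i ≥ 1`). -/
noncomputable def sturmianWord (α θ : ℝ) (i : ℕ) : ℤ :=
  ⌊((i : ℝ) + 1) * α + θ⌋ - ⌊(i : ℝ) * α + θ⌋

/-- The sum of the entries of the `m × n` submatrix of the Hankel matrix of the word `a`
whose upper left entry is `a i`. -/
def rectWeight (a : ℕ → ℤ) (i m n : ℕ) : ℤ :=
  ∑ k ∈ Finset.range m, ∑ l ∈ Finset.range n, a (i + k + l)

/-- The `m × n` rectangles of the word `a = a₁ a₂ a₃ ⋯` are balanced. -/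
def BalancedRectangles (a : ℕ → ℤ) (m n : ℕ) : Prop :=
  ∃ c : ℤ, ∀ i : ℕ, 1 ≤ i → rectWeight a i m n = c ∨ rectWeight a i m n = c + 1

/-! ### Continued fractions: convergents and approximation errors -/

/-! As a function of the phase x = iα + θ on the circle, the weight of a rectangle is the step
function `rectPhase`, which jumps up at the points -(n+k)α and down at the points -kα, k < m. Orbits
are dense and floors are right-continuous, so θ plays no role (`balancedRectangles_iff`). Since m ≤
n and α is irrational, these 2m points are distinct, and balance means that up and down jumps
alternate: the points kα, k < m, and their rotations by nα separate each other. Necessity uses that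
no gap may receive two rotated points (`PhaseBalanced.not_two_points`); sufficiency uses that the
values right after the down jumps agree (`phaseBalanced_of_floor_eq`).

The gaps are those of the three gap theorem. If q_M < m ≤ q_{M+1}, choose r with v < m ≤ u + v,
where u = q_M and v = q_{M-1} + r q_M. The gaps have lengths δ, ε and δ + ε, where δ and ε are the
distances of uα and vα to their approximating integers; the long gap is absent when m = u + v. If nα
is within δ of an integer, balance holds. Otherwise balance forces m = u + v, and nα lies at a
distance z < δ, on a fixed side, from some n₀α with n₀ < m, where z < 2δ - ε if n₀ ≥ u
(`GapBasis.of_phaseBalanced`, `GapBasis.phaseBalanced`).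

To read this in digits, split n at an index K: modulo 1, nα is the low part times α plus (-1)^K
times a tail. The digit rules bound the tail, and it is positive exactly when its first nonzero
digit has even offset, which is the origin of the 2t. Closeness to an integer gives (i) and (ii)
(`IsOstrowski.digits_of_abs_lt`). For m = u + v, the position (n₀, z) is the splitting of n at M + 1
(`IsOstrowski.ostLow_ostTail_eq`): r + 1 = a_{M+1} means m = q_{M+1} and gives (iii), while r + 1 <
a_{M+1} makes 2δ - ε negative, so that n₀ < q_M, and gives (iv). -/

/-- The orbit of `α` under the Gauss map `x ↦ {1 / x}`. -/
noncomputable def gaussOrbit (α : ℝ) : ℕ → ℝ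
  | 0 => Int.fract α
  | k + 1 => Int.fract (gaussOrbit α k)⁻¹

/-- The distances `1, |q₀ α - p₀|, |q₁ α - p₁|, …`; the index is shifted by one, so that the first
entry belongs to `q₋₁ = 0`, `p₋₁ = 1`. -/
noncomputable def convErr (α : ℝ) : ℕ → ℝ
  | 0 => 1
  | k + 1 => convErr α k * gaussOrbit α k

/-- The denominators of the convergents, starting with `q₋₁ = 0`. -/
noncomputable def shiftDen (α : ℝ) : ℕ → ℕ
  | 0 => 0
  | k + 1 => convDen α k

/-- The numerators of the convergents of `α ∈ (0, 1)`, starting with `p₋₁ = 1`, `p₀ = 0`. -/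
noncomputable def shiftNum (α : ℝ) : ℕ → ℕ
  | 0 => 1
  | 1 => 0
  | k + 2 => partQuot α (k + 1) * shiftNum α (k + 1) + shiftNum α k

theorem irrational_fract {x : ℝ} (hx : Irrational x) : Irrational (Int.fract x) := by
  rw [Int.fract]
  exact hx.sub_intCast _

theorem gaussOrbit_irrational {α : ℝ} (hα : Irrational α) (k : ℕ) :
    Irrational (gaussOrbit α k) := by
  induction k with
  | zero => exact irrational_fract hα
  | succ k ih => exact irrational_fract ih.inv

theorem gaussOrbit_pos {α : ℝ} (hα : Irrational α) (k : ℕ) : 0 < gaussOrbit α k := by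
  have h0 : 0 ≤ gaussOrbit α k := by
    cases k <;> exact Int.fract_nonneg _
  exact lt_of_le_of_ne h0 (gaussOrbit_irrational hα k).ne_zero.symm

theorem gaussOrbit_lt_one (α : ℝ) (k : ℕ) : gaussOrbit α k < 1 := by
  cases k <;> exact Int.fract_lt_one _

theorem stream_fr_eq_gaussOrbit {α : ℝ} (hα : Irrational α) (k : ℕ) :
    ∃ b : ℤ, GenContFract.IntFractPair.stream α k = some ⟨b, gaussOrbit α k⟩ := by
  induction k with
  | zero => exact ⟨⌊α⌋, rfl⟩
  | succ k ih =>
    obtain ⟨b, hb⟩ := ih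
    exact ⟨⌊(gaussOrbit α k)⁻¹⌋,
      GenContFract.IntFractPair.stream_succ_of_some hb (gaussOrbit_pos hα k).ne'⟩

theorem partQuot_succ_eq {α : ℝ} (hα : Irrational α) (k : ℕ) :
    (partQuot α (k + 1) : ℝ) = (⌊(gaussOrbit α k)⁻¹⌋ : ℝ) := by
  obtain ⟨b, hb⟩ := stream_fr_eq_gaussOrbit hα k
  have h := GenContFract.get?_of_eq_some_of_get?_intFractPair_stream_fr_ne_zero hb
    (gaussOrbit_pos hα k).ne'
  have h2 := GenContFract.partDen_eq_s_b h
  have h3 := partDens_get?_eq hα k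
  rw [h2] at h3
  exact (Option.some.inj h3).symm

theorem one_le_partQuot_succ {α : ℝ} (hα : Irrational α) (k : ℕ) : 1 ≤ partQuot α (k + 1) := by
  have h1 : (1 : ℤ) ≤ ⌊(gaussOrbit α k)⁻¹⌋ := by
    rw [Int.le_floor]
    have := (one_lt_inv₀ (gaussOrbit_pos hα k)).2 (gaussOrbit_lt_one α k)
    exact_mod_cast this.le
  have h2 : (1 : ℝ) ≤ partQuot α (k + 1) := by
    rw [partQuot_succ_eq hα]
    exact_mod_cast h1
  exact_mod_cast h2

theorem convErr_pos {α : ℝ} (hα : Irrational α) (k : ℕ) : 0 < convErr α k := by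
  induction k with
  | zero => exact one_pos
  | succ k ih => exact mul_pos ih (gaussOrbit_pos hα k)

theorem convErr_succ_lt {α : ℝ} (hα : Irrational α) (k : ℕ) : convErr α (k + 1) < convErr α k := by
  have := mul_lt_mul_of_pos_left (gaussOrbit_lt_one α k) (convErr_pos hα k)
  simpa [convErr] using this

theorem convErr_rec {α : ℝ} (hα : Irrational α) (k : ℕ) :
    convErr α k = partQuot α (k + 1) * convErr α (k + 1) + convErr α (k + 2) := by
  have h0 := (gaussOrbit_pos hα k).ne'
  have h1 : gaussOrbit α (k + 1) = (gaussOrbit α k)⁻¹ - partQuot α (k + 1) := by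
    rw [partQuot_succ_eq hα]; rfl
  have h2 : convErr α (k + 2) = convErr α k * gaussOrbit α k * gaussOrbit α (k + 1) := rfl
  have h3 : convErr α (k + 1) = convErr α k * gaussOrbit α k := rfl
  rw [h2, h3, h1]
  field_simp
  ring

theorem shiftDen_rec (α : ℝ) (k : ℕ) :
    shiftDen α (k + 2) = partQuot α (k + 1) * shiftDen α (k + 1) + shiftDen α k := by
  cases k <;> simp [shiftDen, convDen]

theorem shiftDen_succ_pos {α : ℝ} (hα : Irrational α) (k : ℕ) : 1 ≤ shiftDen α (k + 1) := by
  induction k with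
  | zero => simp [shiftDen, convDen]
  | succ k ih =>
    rw [shiftDen_rec]
    nlinarith [one_le_partQuot_succ hα k]

theorem shiftDen_add_le {α : ℝ} (hα : Irrational α) (k : ℕ) :
    shiftDen α (k + 1) + shiftDen α k ≤ shiftDen α (k + 2) := by
  rw [shiftDen_rec]
  nlinarith [one_le_partQuot_succ hα k, shiftDen_succ_pos hα k]

theorem shiftDen_mono {α : ℝ} (hα : Irrational α) : Monotone (shiftDen α) := by
  refine monotone_nat_of_le_succ fun k => ?_
  cases k with
  | zero => simp [shiftDen]
  | succ k => exact (Nat.le_add_right _ _).trans (shiftDen_add_le hα k)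

theorem le_shiftDen_add {α : ℝ} (hα : Irrational α) (k : ℕ) : k + 1 ≤ shiftDen α (k + 2) := by
  induction k with
  | zero => exact shiftDen_succ_pos hα 1
  | succ k ih =>
    have h1 : shiftDen α (k + 2) + shiftDen α (k + 1) ≤ shiftDen α (k + 1 + 2) :=
      shiftDen_add_le hα (k + 1)
    have h2 := shiftDen_succ_pos hα k
    omega

theorem shiftDen_mul_sub {α : ℝ} (hα : Irrational α) (hα01 : α ∈ Set.Ioo (0 : ℝ) 1) (k : ℕ) :
    (shiftDen α k : ℝ) * α - shiftNum α k = (-1) ^ (k + 1) * convErr α k := by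
  induction k using Nat.twoStepInduction with
  | zero => simp [shiftDen, shiftNum, convErr]
  | one =>
    have : Int.fract α = α := Int.fract_eq_self.2 ⟨hα01.1.le, hα01.2⟩
    simp [shiftDen, shiftNum, convErr, convDen, gaussOrbit, this]
  | more k h0 h1 =>
    have h2 := convErr_rec hα k
    have h3 : convErr α (k + 2) = convErr α k - partQuot α (k + 1) * convErr α (k + 1) := by
      linarith
    rw [shiftDen_rec, shiftNum, h3]
    push_cast
    rw [pow_succ] at h0 h1 ⊢
    rw [pow_succ] at h1 ⊢
    rw [pow_succ]
    linear_combination (partQuot α (k + 1) : ℝ) * h1 + h0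

theorem shiftDen_shiftNum_det (α : ℝ) (k : ℕ) :
    (shiftDen α (k + 1) : ℤ) * shiftNum α k - shiftDen α k * shiftNum α (k + 1) = (-1) ^ k := by
  induction k with
  | zero => simp [shiftDen, shiftNum, convDen]
  | succ k ih =>
    rw [shiftDen_rec, shiftNum]
    push_cast
    rw [pow_succ]
    linear_combination -ih

/-- Each error is at least the sum of the next two, and these decrease, so two steps at least halve
it. -/
theorem convErr_mul_pow_le {α : ℝ} (hα : Irrational α) (k : ℕ) :
    convErr α (2 * k) ≤ (1 / 2) ^ k := by
  induction k with
  | zero => simp [convErr]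
  | succ k ih =>
    have h1 := convErr_rec hα (2 * k)
    have h2 := convErr_succ_lt hα (2 * k + 1)
    have h3 : (1 : ℝ) ≤ partQuot α (2 * k + 1) := by exact_mod_cast one_le_partQuot_succ hα _
    have h4 := convErr_pos hα (2 * k + 1)
    have h5 : 2 * (k + 1) = 2 * k + 2 := by ring
    rw [h5, pow_succ]
    nlinarith

/-- The orbit `α, 2 α, 3 α, …` shifted by `θ` visits every interval modulo `1`. -/
theorem exists_nat_mul_add_mem_Ioo {α : ℝ} (hα : Irrational α) (hα01 : α ∈ Set.Ioo (0 : ℝ) 1)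
    (θ x : ℝ) {w : ℝ} (hw : 0 < w) :
    ∃ i : ℕ, 1 ≤ i ∧ ∃ l : ℤ, (i : ℝ) * α + θ - l ∈ Set.Ioo x (x + w) := by
  obtain ⟨k, hk⟩ := exists_pow_lt_of_lt_one hw (by norm_num : (1 / 2 : ℝ) < 1)
  -- The shifted index 2k + 1 belongs to q_{2k}, whose convergent lies below α: adding q_{2k} to `i`
  -- moves the orbit forward by `s < w`, too little to step over the interval.
  set s := convErr α (2 * k + 1) with hs
  have hs0 : 0 < s := convErr_pos hα _
  have hsw : s < w := (convErr_succ_lt hα _).trans ((convErr_mul_pow_le hα k).trans_lt hk)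
  have hQ := shiftDen_mul_sub hα hα01 (2 * k + 1)
  have hsign : ((-1 : ℝ)) ^ (2 * k + 1 + 1) = 1 := Even.neg_one_pow ⟨k + 1, by ring⟩
  rw [hsign, one_mul, ← hs] at hQ
  obtain ⟨z, hz⟩ := exists_int_gt (α + θ - x)
  set t : ℕ := ⌊(x + z - α - θ) / s⌋₊ + 1 with ht
  have h0 : 0 ≤ (x + z - α - θ) / s := div_nonneg (by linarith) hs0.le
  have h1 : (x + z - α - θ) < t * s := by
    rw [← div_lt_iff₀ hs0, ht]
    push_cast
    exact Nat.lt_floor_add_one _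
  have h2 : (t : ℝ) * s ≤ x + z - α - θ + s := by
    have := Nat.floor_le h0
    rw [le_div_iff₀ hs0] at this
    rw [ht]
    push_cast
    linarith
  refine ⟨1 + t * shiftDen α (2 * k + 1), by omega, z + t * shiftNum α (2 * k + 1), ?_⟩
  have h3 : ((1 + t * shiftDen α (2 * k + 1) : ℕ) : ℝ) * α + θ
      - ((z + t * shiftNum α (2 * k + 1) : ℤ) : ℝ) = α + θ - z + t * s := by
    rw [← hQ]
    push_cast
    ring
  rw [h3]
  constructor <;> linarith

/-! ### Rectangle sums as functions on the circle -/

/-- The weight of the `m × n` rectangle of the Sturmian word with slope `α`, as a function of the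
phase `x = i α + θ` of its upper left corner. -/
noncomputable def rectPhase (α : ℝ) (m n : ℕ) (x : ℝ) : ℤ :=
  ∑ k ∈ Finset.range m, (⌊x + (k + n) * α⌋ - ⌊x + k * α⌋)

/-- `rectPhase` takes at most two values, and these are consecutive. -/
def PhaseBalanced (α : ℝ) (m n : ℕ) : Prop :=
  ∃ c : ℤ, ∀ x : ℝ, rectPhase α m n x = c ∨ rectPhase α m n x = c + 1

theorem rectWeight_sturmianWord (α θ : ℝ) (i m n : ℕ) :
    rectWeight (sturmianWord α θ) i m n = rectPhase α m n (i * α + θ) := by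
  refine Finset.sum_congr rfl fun k _ => ?_
  have h := Finset.sum_range_sub (fun l : ℕ => ⌊((i + k + l : ℕ) : ℝ) * α + θ⌋) n
  simp only [sturmianWord]
  have h2 : ∀ l : ℕ, ⌊(((i + k + l : ℕ) : ℝ) + 1) * α + θ⌋ - ⌊((i + k + l : ℕ) : ℝ) * α + θ⌋
      = ⌊((i + k + (l + 1) : ℕ) : ℝ) * α + θ⌋ - ⌊((i + k + l : ℕ) : ℝ) * α + θ⌋ := by
    intro l
    push_cast
    ring_nf
  rw [Finset.sum_congr rfl fun l _ => h2 l, h]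
  congr 2 <;> (push_cast; ring)

theorem rectPhase_add_int (α : ℝ) (m n : ℕ) (x : ℝ) (l : ℤ) :
    rectPhase α m n (x + l) = rectPhase α m n x := by
  refine Finset.sum_congr rfl fun k _ => ?_
  rw [add_right_comm x (l : ℝ), add_right_comm x (l : ℝ), Int.floor_add_intCast, Int.floor_add_intCast]
  ring

theorem rectPhase_sub_int (α : ℝ) (m n : ℕ) (x : ℝ) (l : ℤ) :
    rectPhase α m n (x - l) = rectPhase α m n x := by
  have := rectPhase_add_int α m n x (-l)
  rw [← this]
  push_cast
  rw [sub_eq_add_neg]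

/-- `⌊·⌋` is locally constant from the right. -/
theorem floor_add_of_lt {x w : ℝ} (hw0 : 0 ≤ w) (hw : w < 1 - Int.fract x) : ⌊x + w⌋ = ⌊x⌋ := by
  have h := Int.floor_add_fract x
  rw [Int.floor_eq_iff]
  constructor <;> linarith [Int.fract_nonneg x]

theorem rectPhase_eq_right (α : ℝ) (m n : ℕ) (x : ℝ) :
    ∃ w : ℝ, 0 < w ∧ ∀ y ∈ Set.Ioo x (x + w), rectPhase α m n y = rectPhase α m n x := by
  have key : ∀ z : ℝ, ∀ᶠ y in nhdsWithin x (Set.Ioi x), ⌊y + z⌋ = ⌊x + z⌋ := by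
    intro z
    have h : 0 < 1 - Int.fract (x + z) := by linarith [Int.fract_lt_one (x + z)]
    filter_upwards [Ioo_mem_nhdsGT (show x < x + (1 - Int.fract (x + z)) by linarith)] with y hy
    have := floor_add_of_lt (x := x + z) (w := y - x) (by linarith [hy.1]) (by linarith [hy.2])
    rw [← this]
    congr 1
    ring
  have h2 : ∀ᶠ y in nhdsWithin x (Set.Ioi x), ∀ k ∈ Finset.range m,
      (⌊y + (k + n) * α⌋ - ⌊y + k * α⌋) = (⌊x + (k + n) * α⌋ - ⌊x + k * α⌋) := by
    rw [Filter.eventually_all_finset]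
    intro k _
    filter_upwards [key ((k + n) * α), key (k * α)] with y h1 h2
    rw [h1, h2]
  have h3 : ∀ᶠ y in nhdsWithin x (Set.Ioi x), rectPhase α m n y = rectPhase α m n x := by
    filter_upwards [h2] with y hy
    exact Finset.sum_congr rfl hy
  obtain ⟨u, hu, hsub⟩ := (mem_nhdsGT_iff_exists_Ioo_subset).1 h3
  refine ⟨u - x, sub_pos.2 hu, fun y hy => hsub ?_⟩
  simpa using hy

/-- Every value of `rectPhase` persists on an interval to the right of the phase, and the orbit
enters that interval; hence no value is missed by the word. -/
theorem balancedRectangles_iff {α : ℝ} (hα : Irrational α) (hα01 : α ∈ Set.Ioo (0 : ℝ) 1)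
    (θ : ℝ) (m n : ℕ) :
    BalancedRectangles (sturmianWord α θ) m n ↔ PhaseBalanced α m n := by
  constructor
  · rintro ⟨c, hc⟩
    refine ⟨c, fun x => ?_⟩
    obtain ⟨w, hw, h⟩ := rectPhase_eq_right α m n x
    obtain ⟨i, hi, l, hl⟩ := exists_nat_mul_add_mem_Ioo hα hα01 θ x hw
    have := hc i hi
    rwa [rectWeight_sturmianWord, ← rectPhase_sub_int α m n _ l, h _ hl] at this
  · rintro ⟨c, hc⟩
    refine ⟨c, fun i _ => ?_⟩
    rw [rectWeight_sturmianWord]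
    exact hc _

/-- Reflection of the circle, with k replaced by m - 1 - k. It allows the sign of q_M α - p_M to be
normalized by passing to (-1)^M α. -/
theorem rectPhase_neg (α : ℝ) (m n : ℕ) (x : ℝ) :
    rectPhase (-α) m n x = -rectPhase α m n (x - (m - 1 + n) * α) := by
  rw [rectPhase, rectPhase, ← Finset.sum_range_reflect, ← Finset.sum_neg_distrib]
  refine Finset.sum_congr rfl fun k hk => ?_
  have hk := Finset.mem_range.1 hk
  have hc : ((m - 1 - k : ℕ) : ℝ) = m - 1 - k := by
    rw [Nat.cast_sub (by omega), Nat.cast_sub (by omega)]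
    simp
  rw [hc, neg_sub]
  congr 2 <;> ring_nf

theorem PhaseBalanced.neg {α : ℝ} {m n : ℕ} (h : PhaseBalanced α m n) :
    PhaseBalanced (-α) m n := by
  obtain ⟨c, hc⟩ := h
  refine ⟨-c - 1, fun x => ?_⟩
  rw [rectPhase_neg]
  rcases hc (x - (m - 1 + n) * α) with h | h <;> rw [h] <;> omega

theorem phaseBalanced_neg_one_pow_mul (α : ℝ) (m n k : ℕ) :
    PhaseBalanced ((-1) ^ k * α) m n ↔ PhaseBalanced α m n := by
  rcases neg_one_pow_eq_or ℝ k with h | h <;> rw [h]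
  · rw [one_mul]
  · rw [neg_one_mul]
    exact ⟨fun h => by simpa using h.neg, fun h => h.neg⟩

/-- If the rectangle sums are balanced, then between two of the points `(n + i) α`, `i < m`, on the
circle there is one of the points `k α`, `k < m`. -/
theorem PhaseBalanced.not_two_points {α : ℝ} {m n : ℕ} (hb : PhaseBalanced α m n) {g h : ℝ}
    (hfree : ∀ k < m, ∀ l : ℤ, g < k * α - l → k * α - l < h → False)
    {i j : ℕ} (hi : i < m) (hj : j < m) (hij : i ≠ j) (l₁ l₂ : ℤ)
    (h₁ : g < (n + i) * α - l₁) (h₁₂ : (n + i) * α - l₁ < (n + j) * α - l₂)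
    (h₂ : (n + j) * α - l₂ < h) : False := by
  set β₁ := ((n : ℝ) + i) * α - l₁ with hβ₁
  set β₂ := ((n : ℝ) + j) * α - l₂ with hβ₂
  -- Between the phases -h' and -β₁ no down jump occurs, while the up jumps of `i` and `j` are both
  -- crossed; the two values then differ by at least 2. Taking h' > β₂ puts the jump at -β₂ strictly
  -- after -h'.
  obtain ⟨h', hh1, hh2⟩ := exists_between h₂
  have hA : ∀ k < m, ⌊-β₁ + k * α⌋ = ⌊-h' + k * α⌋ := by
    intro k hk
    refine le_antisymm ?_ (Int.floor_le_floor (by linarith))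
    by_contra hlt
    have hlt := not_le.1 hlt
    have h3 := Int.floor_le (-β₁ + k * α)
    have h4 := Int.floor_lt.1 hlt
    exact hfree k hk ⌊-β₁ + k * α⌋ (by linarith) (by linarith)
  have hB : ∀ k : ℕ, ⌊-h' + (k + n) * α⌋ ≤ ⌊-β₁ + (k + n) * α⌋ := fun k =>
    Int.floor_le_floor (by linarith)
  have hBi : ⌊-h' + (i + n) * α⌋ + 1 ≤ ⌊-β₁ + (i + n) * α⌋ := by
    have h3 : -β₁ + (i + n) * α = (l₁ : ℝ) := by rw [hβ₁]; ring
    rw [h3, Int.floor_intCast, Int.add_one_le_iff, Int.floor_lt]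
    linarith
  have hBj : ⌊-h' + (j + n) * α⌋ + 1 ≤ ⌊-β₁ + (j + n) * α⌋ := by
    have h3 : -β₂ + (j + n) * α = (l₂ : ℝ) := by rw [hβ₂]; ring
    have h4 : l₂ ≤ ⌊-β₁ + (j + n) * α⌋ := Int.le_floor.2 (by linarith)
    have h5 : ⌊-h' + (j + n) * α⌋ < l₂ := Int.floor_lt.2 (by linarith)
    omega
  have hsum : rectPhase α m n (-h') + 2 ≤ rectPhase α m n (-β₁) := by
    have hij2 : ∑ k ∈ Finset.range m, (if k = i ∨ k = j then (1 : ℤ) else 0) = 2 := by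
      rw [Finset.sum_ite, Finset.sum_const_zero, add_zero, Finset.sum_const]
      have : Finset.filter (fun k => k = i ∨ k = j) (Finset.range m) = {i, j} := by
        ext k
        simp only [Finset.mem_filter, Finset.mem_range, Finset.mem_insert, Finset.mem_singleton]
        constructor
        · exact fun h => h.2
        · rintro (rfl | rfl)
          · exact ⟨hi, Or.inl rfl⟩
          · exact ⟨hj, Or.inr rfl⟩
      rw [this, Finset.card_pair hij]
      norm_num
    rw [← hij2, rectPhase, rectPhase, ← Finset.sum_add_distrib]
    refine Finset.sum_le_sum fun k hk => ?_
    rw [hA k (Finset.mem_range.1 hk)]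
    split_ifs with hk2
    · rcases hk2 with rfl | rfl <;> linarith
    · linarith [hB k]
  obtain ⟨c, hc⟩ := hb
  rcases hc (-h') with h3 | h3 <;> rcases hc (-β₁) with h4 | h4 <;> omega

/-- Moving the phase by α shifts the summation index by one, so the sum telescopes. -/
theorem rectPhase_add_slope (α : ℝ) (m n : ℕ) (x : ℝ) :
    rectPhase α m n (x + α) - rectPhase α m n x
      = (⌊x + (m + n) * α⌋ - ⌊x + m * α⌋) - (⌊x + n * α⌋ - ⌊x⌋) := by
  have h := Finset.sum_range_sub (fun k : ℕ => ⌊x + (k + n) * α⌋ - ⌊x + k * α⌋) m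
  rw [rectPhase, rectPhase, ← Finset.sum_sub_distrib]
  simp only [Nat.cast_zero, zero_add, zero_mul, add_zero] at h
  rw [← h]
  refine Finset.sum_congr rfl fun k _ => ?_
  push_cast
  ring_nf

/-- A criterion for balance: the values of `rectPhase` right after its downward jumps agree. -/
theorem phaseBalanced_of_floor_eq {α : ℝ} (hα : Irrational α) {m n : ℕ} (hm : 1 ≤ m)
    (h : ∀ k : ℕ, 1 ≤ k → k < m →
      ⌊-(k : ℝ) * α + (m + n) * α⌋ - ⌊-(k : ℝ) * α + m * α⌋
        = ⌊-(k : ℝ) * α + n * α⌋ - ⌊-(k : ℝ) * α⌋) : PhaseBalanced α m n := by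
  have hconst : ∀ j : ℕ, j < m → rectPhase α m n (-(j : ℝ) * α) = rectPhase α m n 0 := by
    intro j
    induction j with
    | zero => simp
    | succ j ih =>
      intro hj
      have h1 := rectPhase_add_slope α m n (-((j + 1 : ℕ) : ℝ) * α)
      have h2 := h (j + 1) (by omega) hj
      rw [h2, sub_self] at h1
      have h3 : -((j + 1 : ℕ) : ℝ) * α + α = -(j : ℝ) * α := by push_cast; ring
      rw [h3, ih (by omega)] at h1
      linarith
  refine ⟨rectPhase α m n 0, fun x => ?_⟩
  have hne : (Finset.range m).Nonempty := ⟨0, Finset.mem_range.2 hm⟩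
  have hlow : rectPhase α m n 0 ≤ rectPhase α m n x := by
    -- -jα is the last down jump at or before `x`; from there to `x` only up jumps occur.
    obtain ⟨j, hj, hmin⟩ := Finset.exists_min_image (Finset.range m)
      (fun j : ℕ => Int.fract (x + j * α)) hne
    rw [← hconst j (Finset.mem_range.1 hj)]
    set t := Int.fract (x + j * α) with ht
    have hx : x = -(j : ℝ) * α + t + ⌊x + j * α⌋ := by
      linarith [Int.floor_add_fract (x + j * α)]
    have ht0 : 0 ≤ t := Int.fract_nonneg _
    have ht1 : t < 1 := Int.fract_lt_one _
    rw [hx, rectPhase_add_int]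
    refine Finset.sum_le_sum fun k hk => ?_
    have h1 : ⌊-(j : ℝ) * α + t + k * α⌋ = ⌊-(j : ℝ) * α + k * α⌋ := by
      rw [add_right_comm]
      refine floor_add_of_lt ht0 ?_
      by_contra hcon
      have h3 := Int.floor_add_fract (-(j : ℝ) * α + k * α)
      have h4 := Int.fract_lt_one (-(j : ℝ) * α + k * α)
      have h2 : Int.fract (x + k * α) = Int.fract (-(j : ℝ) * α + k * α) + t - 1 := by
        rw [Int.fract_eq_iff]
        refine ⟨by linarith, by linarith, ⌊x + j * α⌋ + ⌊-(j : ℝ) * α + k * α⌋ + 1, ?_⟩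
        push_cast
        linarith
      have h5 := hmin k hk
      rw [h2] at h5
      linarith
    have h2 : ⌊-(j : ℝ) * α + (k + n) * α⌋ ≤ ⌊-(j : ℝ) * α + t + (k + n) * α⌋ :=
      Int.floor_le_floor (by linarith)
    linarith
  have hhigh : rectPhase α m n x ≤ rectPhase α m n 0 + 1 := by
    -- -jα is now the first down jump after `x`; on the way there, only the subtracted floor of
    -- index `j` changes, and by at most one.
    obtain ⟨j, hj, hmax⟩ := Finset.exists_max_image (Finset.range m)
      (fun j : ℕ => Int.fract (x + j * α)) hne
    rw [← hconst j (Finset.mem_range.1 hj)]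
    set t := 1 - Int.fract (x + j * α) with ht
    have hx : x = -(j : ℝ) * α - t + (⌊x + j * α⌋ + 1 : ℤ) := by
      push_cast
      linarith [Int.floor_add_fract (x + j * α)]
    have ht0 : 0 < t := by linarith [Int.fract_lt_one (x + j * α)]
    have ht1 : t ≤ 1 := by linarith [Int.fract_nonneg (x + j * α)]
    rw [hx, rectPhase_add_int]
    have hone : (1 : ℤ) = ∑ k ∈ Finset.range m, if k = j then 1 else 0 := by
      rw [Finset.sum_ite_eq', if_pos hj]
    rw [hone, rectPhase, rectPhase, ← Finset.sum_add_distrib]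
    refine Finset.sum_le_sum fun k hk => ?_
    have h2 : ⌊-(j : ℝ) * α - t + (k + n) * α⌋ ≤ ⌊-(j : ℝ) * α + (k + n) * α⌋ :=
      Int.floor_le_floor (by linarith)
    split_ifs with hkj
    · subst hkj
      have h3 : -1 ≤ ⌊-(k : ℝ) * α - t + k * α⌋ := Int.le_floor.2 (by push_cast; linarith)
      have h4 : -(k : ℝ) * α + k * α = 0 := by ring
      rw [h4, Int.floor_zero]
      linarith
    · have h1 : ⌊-(j : ℝ) * α + k * α⌋ ≤ ⌊-(j : ℝ) * α - t + k * α⌋ := by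
        rw [Int.le_floor]
        by_contra hcon
        have h3 := Int.floor_add_fract (-(j : ℝ) * α + k * α)
        have hpos : 0 < Int.fract (-(j : ℝ) * α + k * α) := by
          rw [Int.fract_pos]
          intro heq
          have hirr : Irrational (((k - j : ℤ) : ℝ) * α) :=
            hα.intCast_mul (by omega)
          refine hirr.ne_int ⌊-(j : ℝ) * α + k * α⌋ ?_
          rw [← heq]
          push_cast
          ring
        have h2 : Int.fract (x + k * α) = Int.fract (-(j : ℝ) * α + k * α) + 1 - t := by
          rw [Int.fract_eq_iff]
          refine ⟨by linarith, by linarith, ⌊x + j * α⌋ + ⌊-(j : ℝ) * α + k * α⌋, ?_⟩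
          push_cast at hx ⊢
          linarith
        have h5 := hmax k hk
        rw [h2] at h5
        linarith
      linarith
  omega

/-! ### Gaps between the points `k α` on the circle -/

/-- A unimodular pair of a lower approximation `p / u` and an upper approximation `p' / v` of `α`,
with `δ = u α - p` smaller than `ε = p' - v α`. For `u, v < m ≤ u + v` the gaps between the points
`k α`, `k < m`, on the circle have lengths `δ`, `ε` and `δ + ε`. -/
structure GapBasis (α : ℝ) (u v : ℕ) (p p' : ℤ) (δ ε : ℝ) : Prop where
  lower : (u : ℝ) * α - p = δ
  upper : (v : ℝ) * α - p' = -ε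
  det : (u : ℤ) * p' - v * p = 1
  pos : 0 < δ
  lt : δ < ε

namespace GapBasis

variable {α : ℝ} {u v : ℕ} {p p' : ℤ} {δ ε : ℝ}

/-- By the determinant condition (u, p) and (v, p') form a basis of ℤ², and the linear form kα - l
takes the values δ and -ε on it. -/
theorem coords (H : GapBasis α u v p p' δ ε) (k l : ℤ) :
    ∃ x y : ℤ, k = x * u + y * v ∧ (k : ℝ) * α - l = x * δ - y * ε := by
  have hk : k = (k * p' - l * v) * u + (l * u - k * p) * v := by linear_combination -k * H.det
  have hl : l = (k * p' - l * v) * p + (l * u - k * p) * p' := by linear_combination -l * H.det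
  refine ⟨k * p' - l * v, l * u - k * p, hk, ?_⟩
  rw [← H.lower]
  have hε : ε = -((v : ℝ) * α - p') := by rw [H.upper, neg_neg]
  rw [hε]
  have hk' : (k : ℝ) = (k * p' - l * v) * u + (l * u - k * p) * v := by exact_mod_cast hk
  have hl' : (l : ℝ) = (k * p' - l * v) * p + (l * u - k * p) * p' := by exact_mod_cast hl
  push_cast
  linear_combination α * hk' - hl'

/-- If `x δ - y ε > 0` and `y ≥ 1`, then `x ≥ 1`. -/
theorem x_pos (H : GapBasis α u v p p' δ ε) {x y : ℤ} (hy : 1 ≤ y)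
    (h : -ε < (x : ℝ) * δ - y * ε) : 1 ≤ x := by
  have h1 : (1 : ℝ) ≤ y := by exact_mod_cast hy
  have h2 := H.pos
  have h3 := H.lt
  by_contra hx
  have hx1 : (x : ℝ) ≤ 0 := by exact_mod_cast (by omega : x ≤ 0)
  nlinarith

theorem x_neg (H : GapBasis α u v p p' δ ε) {x y : ℤ} (hy : y ≤ -1)
    (h : (x : ℝ) * δ - y * ε < ε) : x ≤ -1 := by
  have h1 : (y : ℝ) ≤ -1 := by exact_mod_cast hy
  have h2 := H.pos
  have h3 := H.lt
  by_contra hx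
  have hx1 : (0 : ℝ) ≤ x := by exact_mod_cast (by omega : 0 ≤ x)
  nlinarith

/-- No point `k α` with `0 < k < u + v` lies in `(-ε, 0)`. -/
theorem free_left (H : GapBasis α u v p p' δ ε) {k l : ℤ} (hk0 : 0 < k) (hk : k < u + v)
    (h0 : -ε < (k : ℝ) * α - l) (h1 : (k : ℝ) * α - l < 0) : False := by
  obtain ⟨x, y, hkxy, hv⟩ := H.coords k l
  rw [hv] at h0 h1
  have h2 := H.pos
  have h3 := H.lt
  rcases lt_trichotomy y 0 with hy | hy | hy
  · have := H.x_neg (by omega) (h1.trans (h2.trans h3))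
    nlinarith
  · subst hy
    have : x ≤ -1 := by
      by_contra hx
      have hx1 : (0 : ℝ) ≤ x := by exact_mod_cast (by omega : 0 ≤ x)
      push_cast at h1
      nlinarith
    nlinarith
  · have := H.x_pos (by omega) h0
    nlinarith

/-- No point `k α` with `-(u + v) < k < u` lies in `(0, ε)`. -/
theorem free_long (H : GapBasis α u v p p' δ ε) {k l : ℤ} (hk0 : -(u + v : ℤ) < k) (hk : k < u)
    (h0 : 0 < (k : ℝ) * α - l) (h1 : (k : ℝ) * α - l < ε) : False := by
  obtain ⟨x, y, hkxy, hv⟩ := H.coords k l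
  rw [hv] at h0 h1
  have h2 := H.pos
  have h3 := H.lt
  rcases lt_trichotomy y 0 with hy | hy | hy
  · have := H.x_neg (by omega) h1
    nlinarith
  · subst hy
    have : 1 ≤ x := by
      by_contra hx
      have hx1 : (x : ℝ) ≤ 0 := by exact_mod_cast (by omega : x ≤ 0)
      push_cast at h0
      nlinarith
    nlinarith
  · have := H.x_pos (x := x) (y := y) (by omega) (by linarith)
    nlinarith

/-- No point `k α` with `|k| < u + v` lies in `(0, δ)`. -/
theorem free_short (H : GapBasis α u v p p' δ ε) {k l : ℤ} (hk0 : -(u + v : ℤ) < k)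
    (hk : k < u + v) (h0 : 0 < (k : ℝ) * α - l) (h1 : (k : ℝ) * α - l < δ) : False := by
  obtain ⟨x, y, hkxy, hv⟩ := H.coords k l
  rw [hv] at h0 h1
  have h2 := H.pos
  have h3 := H.lt
  rcases lt_trichotomy y 0 with hy | hy | hy
  · have := H.x_neg (by omega) (h1.trans h3)
    nlinarith
  · subst hy
    push_cast at h0 h1
    have hx0 : (0 : ℝ) < x := by
      by_contra hx
      nlinarith
    have hx1 : (x : ℝ) < 1 := by
      by_contra hx
      nlinarith
    have h5 : 0 < x := by exact_mod_cast hx0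
    have h6 : x < 1 := by exact_mod_cast hx1
    omega
  · have := H.x_pos (x := x) (y := y) (by omega) (by linarith)
    nlinarith

/-- No point `k α` with `-v < k < u` lies in `(0, δ + ε)`. -/
theorem free_sum (H : GapBasis α u v p p' δ ε) {k l : ℤ} (hk0 : -(v : ℤ) < k) (hk : k < u)
    (h0 : 0 < (k : ℝ) * α - l) (h1 : (k : ℝ) * α - l < δ + ε) : False := by
  obtain ⟨x, y, hkxy, hv⟩ := H.coords k l
  rw [hv] at h0 h1
  have h2 := H.pos
  have h3 := H.lt
  rcases lt_trichotomy y 0 with hy | hy | hy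
  · have : x ≤ 0 := by
      by_contra hx
      have hx1 : (1 : ℝ) ≤ x := by exact_mod_cast (by omega : 1 ≤ x)
      have hy1 : (y : ℝ) ≤ -1 := by exact_mod_cast (by omega : y ≤ -1)
      nlinarith
    nlinarith
  · subst hy
    have : 1 ≤ x := by
      by_contra hx
      have hx1 : (x : ℝ) ≤ 0 := by exact_mod_cast (by omega : x ≤ 0)
      push_cast at h0
      nlinarith
    nlinarith
  · have := H.x_pos (x := x) (y := y) (by omega) (by linarith)
    nlinarith

end GapBasis

/-! ### Balance in terms of the gaps -/

theorem floor_sub_eq_of_free {x w : ℝ} (hw : 0 ≤ w)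
    (h : ∀ c : ℤ, 0 ≤ x - c → x - c < w → False) : ⌊x - w⌋ = ⌊x⌋ := by
  refine le_antisymm (Int.floor_le_floor (by linarith)) ?_
  rw [Int.le_floor]
  by_contra hcon
  exact h ⌊x⌋ (by linarith [Int.floor_le x]) (by linarith)

theorem floor_add_eq_of_free {x y : ℝ} (h : ∀ c : ℤ, |x - c| ≤ |y| → False) :
    ⌊x + y⌋ = ⌊x⌋ := by
  rcases le_total 0 y with hy | hy
  · have h1 := floor_sub_eq_of_free (x := x + y) (w := y) hy fun c h0 h1 => h c (by
      rw [abs_of_nonneg hy, abs_le]; constructor <;> linarith)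
    rw [← h1, add_sub_cancel_right]
  · have h1 := floor_sub_eq_of_free (x := x) (w := -y) (by linarith) fun c h0 h1 => h c (by
      rw [abs_of_nonpos hy, abs_le]; constructor <;> linarith)
    rw [← h1, sub_neg_eq_add]

/-- Balance holds if `n α` is closer to the integers than `α, 2 α, …, (m - 1) α`. -/
theorem phaseBalanced_of_dist_lt {α : ℝ} (hα : Irrational α) {m n : ℕ} (hm : 1 ≤ m) (l : ℤ)
    (h : ∀ k : ℕ, 1 ≤ k → k < m → ∀ c : ℤ, |(n : ℝ) * α - l| < |(k : ℝ) * α - c|) :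
    PhaseBalanced α m n := by
  refine phaseBalanced_of_floor_eq hα hm fun k hk hkm => ?_
  have h1 : ⌊-(k : ℝ) * α + m * α + (n * α - l)⌋ = ⌊-(k : ℝ) * α + m * α⌋ := by
    refine floor_add_eq_of_free fun c hc => ?_
    have h2 := h (m - k) (by omega) (by omega) c
    rw [Nat.cast_sub hkm.le] at h2
    have h3 : ((m : ℝ) - k) * α - c = -(k : ℝ) * α + m * α - c := by ring
    rw [h3] at h2
    linarith
  have h2 : ⌊-(k : ℝ) * α + (n * α - l)⌋ = ⌊-(k : ℝ) * α⌋ := by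
    refine floor_add_eq_of_free fun c hc => ?_
    have h2 := h k hk hkm (-c)
    have h3 : (k : ℝ) * α - (-c : ℤ) = -(-(k : ℝ) * α - c) := by push_cast; ring
    rw [h3, abs_neg] at h2
    linarith
  have h3 : -(k : ℝ) * α + (m + n) * α = -(k : ℝ) * α + m * α + (n * α - l) + l := by ring
  have h4 : -(k : ℝ) * α + n * α = -(k : ℝ) * α + (n * α - l) + l := by ring
  rw [h3, h4, Int.floor_add_intCast, Int.floor_add_intCast, h1, h2]
  ring

namespace GapBasis

variable {α : ℝ} {u v : ℕ} {p p' : ℤ} {δ ε : ℝ}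

/-- The sufficient condition when there are only two gap lengths. -/
theorem phaseBalanced (H : GapBasis α u v p p' δ ε) (hα : Irrational α) {n n₀ : ℕ}
    (huv : 1 ≤ u + v) (l : ℤ) {z : ℝ} (hn : (n : ℝ) * α - l = n₀ * α - z) (hz0 : 0 < z)
    (hz : z < δ) (hn₀ : n₀ < u + v) (hz' : u ≤ n₀ → z < 2 * δ - ε) :
    PhaseBalanced α (u + v) n := by
  refine phaseBalanced_of_floor_eq hα huv fun k hk hkm => ?_
  have hδ := H.pos
  have hlt := H.lt
  -- For m = u + v, rotation by mα is a backward rotation by only ε - δ; the criterion asks that it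
  -- carry neither -kα nor (n - k)α across an integer.
  have hm : ((u + v : ℕ) : ℝ) * α = (p + p' : ℤ) - (ε - δ) := by
    push_cast
    linear_combination H.lower + H.upper
  have h1 : ⌊-(k : ℝ) * α - (ε - δ)⌋ = ⌊-(k : ℝ) * α⌋ := by
    refine floor_sub_eq_of_free (by linarith) fun c h0 h1 => ?_
    rcases h0.eq_or_lt with h0 | h0
    · have hirr : Irrational (((-k : ℤ) : ℝ) * α) := hα.intCast_mul (by omega)
      refine hirr.ne_int c ?_
      push_cast
      linarith
    · refine H.free_left (k := k) (l := -c) (by omega) (by omega) ?_ ?_ <;> push_cast <;> linarith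
  have h2 : ⌊-(k : ℝ) * α + n * α - (ε - δ)⌋ = ⌊-(k : ℝ) * α + n * α⌋ := by
    refine floor_sub_eq_of_free (by linarith) fun c h0 h1 => ?_
    -- The forbidden window reaches from z to z + ε - δ. For n₀ < u it fits into (0, ε) because z <
    -- δ; otherwise only (0, δ) is known to be free, whence the bound 2δ - ε.
    rcases lt_or_ge n₀ u with hu | hu
    · refine H.free_long (k := n₀ - k) (l := c - l) (by omega) (by omega) ?_ ?_ <;>
        push_cast <;> linarith
    · have := hz' hu
      refine H.free_short (k := n₀ - k) (l := c - l) (by omega) (by omega) ?_ ?_ <;>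
        push_cast <;> linarith
  have h3 : -(k : ℝ) * α + ((u + v : ℕ) + n) * α
      = -(k : ℝ) * α + n * α - (ε - δ) + (p + p' : ℤ) := by rw [add_mul, hm]; ring
  have h4 : -(k : ℝ) * α + (u + v : ℕ) * α = -(k : ℝ) * α - (ε - δ) + (p + p' : ℤ) := by
    rw [hm]; ring
  rw [h3, h4, Int.floor_add_intCast, Int.floor_add_intCast, h1, h2]
  ring

theorem int_mul_ne (hα : Irrational α) {k : ℤ} (hk : k ≠ 0) (l : ℤ) (h : (k : ℝ) * α = l) :
    False :=
  (hα.intCast_mul hk).ne_int l h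

/-- The necessary condition for balance. -/
theorem of_phaseBalanced (H : GapBasis α u v p p' δ ε) (hα : Irrational α) {m n : ℕ}
    (hu : 1 ≤ u) (hum : u < m) (hv : 1 ≤ v) (hvm : v < m) (hm : m ≤ u + v) (hmn : m ≤ n)
    (hb : PhaseBalanced α m n) :
    (∃ l : ℤ, |(n : ℝ) * α - l| < δ) ∨
      (u + v = m ∧ ∃ (n₀ : ℕ) (l : ℤ) (z : ℝ), (n : ℝ) * α - l = n₀ * α - z ∧ 0 < z ∧ z < δ ∧
        n₀ < m ∧ (u ≤ n₀ → z < 2 * δ - ε)) := by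
  have hδ := H.pos
  have hlt := H.lt
  have hlow := H.lower
  have hupp := H.upper
  -- jα is the closest of the points kα, k < m, behind nα, and `x` is the distance. The cases below
  -- follow the gap starting at jα: δ if j + u < m, ε if j ≥ v, and δ + ε otherwise.
  obtain ⟨j, hj, hmin⟩ := Finset.exists_min_image (Finset.range m)
    (fun j : ℕ => Int.fract ((n : ℝ) * α - j * α)) ⟨0, Finset.mem_range.2 (by omega)⟩
  have hj := Finset.mem_range.1 hj
  set x := Int.fract ((n : ℝ) * α - j * α) with hx
  set l := ⌊(n : ℝ) * α - j * α⌋ with hl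
  have hn : (n : ℝ) * α = j * α + l + x := by
    linarith [Int.floor_add_fract ((n : ℝ) * α - j * α)]
  have hx0 : 0 < x := by
    refine lt_of_le_of_ne (Int.fract_nonneg _) fun h0 => ?_
    refine int_mul_ne hα (k := n - j) (by omega) l ?_
    push_cast
    linarith
  have hx1 : x < 1 := Int.fract_lt_one _
  have hsucc : ∀ i < m, ∀ (c : ℤ) (g : ℝ), 0 < g → (i : ℝ) * α = j * α + c + g → x < g := by
    intro i hi c g hg hig
    by_contra hcon
    have h1 : Int.fract ((n : ℝ) * α - i * α) = x - g := by
      rw [Int.fract_eq_iff]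
      refine ⟨by linarith, by linarith, l - c, ?_⟩
      push_cast
      linarith
    have h2 := hmin i (Finset.mem_range.2 hi)
    rw [h1] at h2
    linarith
  -- the gap that starts at `i`
  have hsum : ∀ i : ℕ, m ≤ i + u → i < v → ∀ k < m, ∀ c : ℤ, (i : ℝ) * α < k * α - c →
      (k : ℝ) * α - c < i * α + (δ + ε) → False := by
    intro i hi1 hi2 k hk c h0 h1
    refine H.free_sum (k := k - i) (l := c) (by omega) (by omega) ?_ ?_ <;> push_cast <;> linarith
  have hlong : ∀ i : ℕ, i < m → v ≤ i → ∀ k < m, ∀ c : ℤ, (i : ℝ) * α < k * α - c →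
      (k : ℝ) * α - c < i * α + ε → False := by
    intro i hi1 hi2 k hk c h0 h1
    refine H.free_long (k := k - i) (l := c) (by omega) (by omega) ?_ ?_ <;> push_cast <;> linarith
  rcases lt_or_ge (j + u) m with hju | hju
  · have hxδ : x < δ := hsucc (j + u) hju p δ hδ (by push_cast; linarith)
    rcases Nat.eq_zero_or_pos j with rfl | hj0
    · left
      refine ⟨l, ?_⟩
      push_cast at hn
      rw [abs_of_pos] <;> linarith
    · have hc1 : ((m - u - j : ℕ) : ℝ) = m - u - j := by
        rw [Nat.cast_sub (by omega), Nat.cast_sub (by omega)]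
      have hc2 : ((m - j : ℕ) : ℝ) = m - j := Nat.cast_sub hj.le
      have hc3 : ((m - u : ℕ) : ℝ) = m - u := Nat.cast_sub hum.le
      rcases hm.lt_or_eq with hm3 | hm2
      · exfalso
        -- If m < u + v, a gap of length δ + ε starts at (m - u)α. The rotated points of indices m -
        -- u - j and m - j fall into it, at distances x and x + δ from its start.
        refine hb.not_two_points (hsum (m - u) (by omega) (by omega)) (i := m - u - j)
          (j := m - j) (by omega) (by omega) (by omega) l (l + p) ?_ ?_ ?_ <;>
          rw [add_mul] <;> (try rw [add_mul]) <;> push_cast [hc1, hc2, hc3] <;> linarith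
      · right
        -- The position is measured back from the far end (j + u)α of the gap.
        refine ⟨hm2.symm, j + u, l - p, δ - x, ?_, by linarith, by linarith, hju, fun _ => ?_⟩
        · push_cast
          linarith
        by_contra hcon
        have hxle : x ≤ ε - δ := by linarith
        rcases hxle.lt_or_eq with hxlt | hxeq
        · refine hb.not_two_points (hlong (m - u) (by omega) (by omega)) (i := m - u - j)
            (j := m - j) (by omega) (by omega) (by omega) l (l + p) ?_ ?_ ?_ <;>
            rw [add_mul] <;> (try rw [add_mul]) <;> push_cast [hc1, hc2, hc3] <;> linarith
        · refine int_mul_ne hα (k := n - j + u + v) (by omega) (l + p + p') ?_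
          push_cast
          linarith
  rcases le_or_gt v j with hvj | hvj
  · have hcj : ((j - v : ℕ) : ℝ) = j - v := Nat.cast_sub hvj
    have hxε : x < ε := hsucc (j - v) (by omega) (-p') ε (by linarith) (by
      rw [hcj]; push_cast; linarith)
    rcases lt_trichotomy x (ε - δ) with hxlt | hxeq | hxgt
    · exfalso
      refine hb.not_two_points (hlong j hj hvj) (i := 0) (j := u) (by omega) hum (by omega)
        l (l + p) ?_ ?_ ?_ <;> push_cast <;> linarith
    · exfalso
      refine int_mul_ne hα (k := n - j + u + v) (by omega) (l + p + p') ?_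
      push_cast
      linarith
    · rcases hvj.eq_or_lt with rfl | hvj'
      · left
        refine ⟨l + p', ?_⟩
        push_cast
        rw [abs_of_neg] <;> linarith
      · rcases hm.lt_or_eq with hm3 | hm2
        · exfalso
          have hc1 : ((m - j + v : ℕ) : ℝ) = m - j + v := by
            rw [Nat.cast_add, Nat.cast_sub (by omega)]
          have hc2 : ((m - j : ℕ) : ℝ) = m - j := Nat.cast_sub hj.le
          have hc3 : ((m - u : ℕ) : ℝ) = m - u := Nat.cast_sub hum.le
          refine hb.not_two_points (hsum (m - u) (by omega) (by omega)) (i := m - j + v)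
            (j := m - j) (by omega) (by omega) (by omega) (l + p + p') (l + p) ?_ ?_ ?_ <;>
            rw [add_mul] <;> (try rw [add_mul]) <;> push_cast [hc1, hc2, hc3] <;> linarith
        · right
          -- The far end of this gap is (j - v)α; as j - v < u, the extra bound on z is void.
          refine ⟨hm2.symm, j - v, l + p', ε - x, ?_, by linarith, by linarith, by omega,
            fun _ => by omega⟩
          rw [hcj]
          push_cast
          linarith
  · exfalso
    have hcj : ((j + u - v : ℕ) : ℝ) = j + u - v := by
      rw [Nat.cast_sub (by omega), Nat.cast_add]
    have hxs : x < δ + ε := hsucc (j + u - v) (by omega) (p - p') (δ + ε) (by linarith) (by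
      rw [hcj]; push_cast; linarith)
    rcases lt_trichotomy x ε with hxlt | hxeq | hxgt
    · refine hb.not_two_points (hsum j hju hvj) (i := 0) (j := u) (by omega) hum (by omega)
        l (l + p) ?_ ?_ ?_ <;> push_cast <;> linarith
    · refine int_mul_ne hα (k := n - j + v) (by omega) (l + p') ?_
      push_cast
      linarith
    · refine hb.not_two_points (hsum j hju hvj) (i := v) (j := 0) hvm (by omega) (by omega)
        (l + p') l ?_ ?_ ?_ <;> push_cast <;> linarith

end GapBasis

/-! ### Ostrowski representations -/

/-- The part `∑_{k < K} d k * q k` of an Ostrowski representation. -/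
noncomputable def ostLow (α : ℝ) (d : ℕ →₀ ℕ) (K : ℕ) : ℕ :=
  ∑ k ∈ Finset.range K, d k * shiftDen α (k + 1)

/-- The number `(-1) ^ K * ∑_{k ≥ K} d k * (q k * α - p k)`. -/
noncomputable def ostTail (α : ℝ) (d : ℕ →₀ ℕ) (K : ℕ) : ℝ :=
  (-1) ^ K * ((d.sum fun k c => (c : ℝ) * ((-1) ^ k * convErr α (k + 1)))
    - ∑ k ∈ Finset.range K, (d k : ℝ) * ((-1) ^ k * convErr α (k + 1)))

theorem finsupp_sum_eq_range {R : Type*} [AddCommMonoid R] (d : ℕ →₀ ℕ) (f : ℕ → ℕ → R)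
    (hf : ∀ k, f k 0 = 0) {T : ℕ} (hT : ∀ k, T ≤ k → d k = 0) :
    d.sum f = ∑ k ∈ Finset.range T, f k (d k) := by
  refine Finsupp.sum_of_support_subset d (fun k hk => ?_) f fun k _ => hf k
  rw [Finset.mem_range]
  by_contra hcon
  exact (Finsupp.mem_support_iff.1 hk) (hT k (not_lt.1 hcon))

theorem finsupp_exists_bound (d : ℕ →₀ ℕ) : ∃ T, ∀ k, T ≤ k → d k = 0 := by
  refine ⟨d.support.sup id + 1, fun k hk => ?_⟩
  by_contra hcon
  have := Finset.le_sup (f := id) (Finsupp.mem_support_iff.2 hcon)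
  simp only [id] at this
  omega

theorem ostTail_rec (α : ℝ) (d : ℕ →₀ ℕ) (K : ℕ) :
    ostTail α d K = d K * convErr α (K + 1) - ostTail α d (K + 1) := by
  have h : ((-1 : ℝ) ^ K) * (-1) ^ K = 1 := by rw [← mul_pow]; norm_num
  rw [ostTail, ostTail, Finset.sum_range_succ, pow_succ]
  linear_combination ((d K : ℝ) * convErr α (K + 1)) * h

theorem ostTail_eq_zero (α : ℝ) (d : ℕ →₀ ℕ) {T : ℕ} (hT : ∀ k, T ≤ k → d k = 0) :
    ostTail α d T = 0 := by
  rw [ostTail, finsupp_sum_eq_range d _ (by simp) hT, sub_self, mul_zero]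

theorem ostLow_succ (α : ℝ) (d : ℕ →₀ ℕ) (K : ℕ) :
    ostLow α d (K + 1) = ostLow α d K + d K * shiftDen α (K + 1) :=
  Finset.sum_range_succ _ _

theorem ostLow_eq_zero_iff {α : ℝ} (hα : Irrational α) (d : ℕ →₀ ℕ) (K : ℕ) :
    ostLow α d K = 0 ↔ ∀ k, k < K → d k = 0 := by
  rw [ostLow, Finset.sum_eq_zero_iff]
  refine forall_congr' fun k => ?_
  have := shiftDen_succ_pos hα k
  simp only [Finset.mem_range, mul_eq_zero]
  exact ⟨fun h hk => (h hk).resolve_right (by omega), fun h hk => Or.inl (h hk)⟩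

namespace IsOstrowski

variable {α : ℝ} {d : ℕ →₀ ℕ} {n : ℕ}

theorem eq_ostLow (h : IsOstrowski α d n) {T : ℕ} (hT : ∀ k, T ≤ k → d k = 0) :
    n = ostLow α d T := by
  rw [h.sum_eq, finsupp_sum_eq_range d _ (by simp) hT]
  rfl

theorem ostLow_le (h : IsOstrowski α d n) (K : ℕ) : ostLow α d K ≤ n := by
  obtain ⟨T, hT⟩ := finsupp_exists_bound d
  rw [h.eq_ostLow (T := max T K) fun k hk => hT k ((le_max_left _ _).trans hk)]
  exact Finset.sum_le_sum_of_subset (Finset.range_mono (le_max_right _ _))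

theorem digit_le' (h : IsOstrowski α d n) (k : ℕ) : d k ≤ partQuot α (k + 1) := by
  rcases Nat.eq_zero_or_pos k with rfl | hk
  · exact (Nat.le_succ _).trans h.digit_zero
  · exact h.digit_le k hk

/-- A maximal digit would leave no room for a full lower block, but the digit rule then makes the
preceding digit vanish. -/
theorem ostLow_lt (h : IsOstrowski α d n) (hα : Irrational α) (K : ℕ) :
    ostLow α d K < shiftDen α (K + 1) := by
  induction K using Nat.twoStepInduction with
  | zero => simp [ostLow, shiftDen, convDen]
  | one =>
    have := h.digit_zero
    simp only [ostLow, Finset.sum_range_one, shiftDen, convDen]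
    omega
  | more K h0 h1 =>
    rw [ostLow_succ, shiftDen_rec α (K + 1)]
    have hp := shiftDen_succ_pos hα (K + 1)
    rcases (h.digit_le' (K + 1)).lt_or_eq with hlt | heq
    · have : (d (K + 1) + 1) * shiftDen α (K + 1 + 1)
          ≤ partQuot α (K + 1 + 1) * shiftDen α (K + 1 + 1) := Nat.mul_le_mul_right _ hlt
      linarith
    · have hz : d K = 0 := h.digit_rule (K + 1) (by omega) heq
      rw [heq, ostLow_succ, hz]
      linarith

/-- Downward induction from beyond the last nonzero digit: the recursions of the tail and of the
errors match, so each bound at K comes from the opposite one at K + 1. -/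
theorem ostTail_bounds (h : IsOstrowski α d n) (hα : Irrational α) (K : ℕ) :
    -convErr α (K + 1) < ostTail α d K ∧ ostTail α d K < convErr α K := by
  obtain ⟨T, hT⟩ := finsupp_exists_bound d
  have down : ∀ i K, T ≤ K + i →
      -convErr α (K + 1) < ostTail α d K ∧ ostTail α d K < convErr α K := by
    intro i
    induction i with
    | zero =>
      intro K hK
      rw [ostTail_eq_zero α d (T := K) fun k hk => hT k (hK.trans hk)]
      exact ⟨neg_lt_zero.2 (convErr_pos hα _), convErr_pos hα _⟩
    | succ i ih =>
      intro K hK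
      obtain ⟨h1, h2⟩ := ih (K + 1) (by omega)
      rw [ostTail_rec, convErr_rec hα K]
      have hp := convErr_pos hα (K + 1)
      have hd0 : (0 : ℝ) ≤ d K := Nat.cast_nonneg _
      have hd1 : (d K : ℝ) ≤ partQuot α (K + 1) := by exact_mod_cast h.digit_le' K
      constructor
      · nlinarith
      · have : convErr α (K + 1 + 1) = convErr α (K + 2) := rfl
        nlinarith
  exact down T K (by omega)

theorem ostTail_lt (h : IsOstrowski α d n) (hα : Irrational α) {K : ℕ}
    (hd : d K < partQuot α (K + 1)) : ostTail α d K < convErr α K - convErr α (K + 1) := by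
  obtain ⟨h1, -⟩ := h.ostTail_bounds hα (K + 1)
  rw [ostTail_rec, convErr_rec hα K]
  have hp := convErr_pos hα (K + 1)
  have hd1 : (d K : ℝ) + 1 ≤ partQuot α (K + 1) := by exact_mod_cast hd
  have : convErr α (K + 1 + 1) = convErr α (K + 2) := rfl
  nlinarith

theorem ostTail_pos (h : IsOstrowski α d n) (hα : Irrational α) {K : ℕ} (hd : d K ≠ 0) :
    0 < ostTail α d K := by
  obtain ⟨-, h2⟩ := h.ostTail_bounds hα (K + 1)
  rw [ostTail_rec]
  have hp := convErr_pos hα (K + 1)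
  have hd1 : (1 : ℝ) ≤ d K := by exact_mod_cast Nat.one_le_iff_ne_zero.2 hd
  nlinarith

/-- The tail is positive if and only if its first nonzero digit has an even offset. -/
theorem ostTail_pos_iff (h : IsOstrowski α d n) (hα : Irrational α) (K : ℕ) :
    0 < ostTail α d K ↔ ∃ t, (∀ k, K ≤ k → k < K + 2 * t → d k = 0) ∧ d (K + 2 * t) ≠ 0 := by
  constructor
  · obtain ⟨T, hT⟩ := finsupp_exists_bound d
    have down : ∀ i K, T ≤ K + 2 * i → 0 < ostTail α d K →
        ∃ t, (∀ k, K ≤ k → k < K + 2 * t → d k = 0) ∧ d (K + 2 * t) ≠ 0 := by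
      intro i
      induction i with
      | zero =>
        intro K hK hpos
        rw [ostTail_eq_zero α d fun k hk => hT k (le_trans (by omega) hk)] at hpos
        exact absurd hpos (lt_irrefl _)
      | succ i ih =>
        intro K hK hpos
        by_cases h0 : d K = 0
        · have h1 : d (K + 1) = 0 := by
            by_contra hcon
            have := h.ostTail_pos hα hcon
            rw [ostTail_rec, h0] at hpos
            push_cast at hpos
            linarith
          have hpos2 : 0 < ostTail α d (K + 2) := by
            rw [ostTail_rec, ostTail_rec, h0, h1] at hpos
            push_cast at hpos
            have : ostTail α d (K + 1 + 1) = ostTail α d (K + 2) := rfl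
            linarith
          obtain ⟨t, ht1, ht2⟩ := ih (K + 2) (by omega) hpos2
          refine ⟨t + 1, fun k hk1 hk2 => ?_, ?_⟩
          · rcases (by omega : k = K ∨ k = K + 1 ∨ K + 2 ≤ k) with rfl | rfl | hk
            · exact h0
            · exact h1
            · exact ht1 k hk (by omega)
          · have : K + 2 * (t + 1) = K + 2 + 2 * t := by ring
            rwa [this]
        · exact ⟨0, fun k _ _ => by omega, by simpa using h0⟩
    exact down T K (by omega)
  · rintro ⟨t, ht⟩
    induction t generalizing K with
    | zero => exact h.ostTail_pos hα (by simpa using ht.2)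
    | succ t ih =>
      have h0 := ht.1 K le_rfl (by omega)
      have h1 := ht.1 (K + 1) (by omega) (by omega)
      have e : K + 2 * (t + 1) = K + 2 + 2 * t := by ring
      have := ih (K + 2) ⟨fun k hk1 hk2 => ht.1 k (by omega) (by omega), e ▸ ht.2⟩
      rw [ostTail_rec, ostTail_rec, h0, h1]
      push_cast
      have e2 : ostTail α d (K + 1 + 1) = ostTail α d (K + 2) := rfl
      linarith

/-- Modulo 1, each q_k α with k ≥ K may be replaced by its signed error. -/
theorem exists_int_eq (h : IsOstrowski α d n) (hα : Irrational α)
    (hα01 : α ∈ Set.Ioo (0 : ℝ) 1) (K : ℕ) :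
    ∃ l : ℤ, (n : ℝ) * α - l = ostLow α d K * α + (-1) ^ K * ostTail α d K := by
  obtain ⟨T, hT⟩ := finsupp_exists_bound d
  have hpow : ((-1 : ℝ) ^ K) * (-1) ^ K = 1 := by rw [← mul_pow]; norm_num
  have hQ : ∀ L : ℕ, (ostLow α d L : ℝ) * α
      - ((∑ k ∈ Finset.range L, d k * shiftNum α (k + 1) : ℕ) : ℝ)
      = ∑ k ∈ Finset.range L, (d k : ℝ) * ((-1) ^ k * convErr α (k + 1)) := by
    intro L
    rw [ostLow]
    push_cast
    rw [Finset.sum_mul, ← Finset.sum_sub_distrib]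
    refine Finset.sum_congr rfl fun k _ => ?_
    have h1 := shiftDen_mul_sub hα hα01 (k + 1)
    rw [pow_succ, pow_succ] at h1
    linear_combination (d k : ℝ) * h1
  have h1 := hQ T
  have h2 := hQ K
  rw [← h.eq_ostLow hT] at h1
  refine ⟨((∑ k ∈ Finset.range T, d k * shiftNum α (k + 1) : ℕ) : ℤ)
    - ((∑ k ∈ Finset.range K, d k * shiftNum α (k + 1) : ℕ) : ℤ), ?_⟩
  rw [ostTail, finsupp_sum_eq_range d _ (by simp) hT, ← h1, ← h2]
  push_cast
  linear_combination (-((n : ℝ) * α - (∑ k ∈ Finset.range T, (d k : ℝ) * shiftNum α (k + 1))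
    - (ostLow α d K * α - (∑ k ∈ Finset.range K, (d k : ℝ) * shiftNum α (k + 1))))) * hpow

theorem digit_eq_zero_of_lt (h : IsOstrowski α d n) (hα : Irrational α) {K : ℕ}
    (hn : n < shiftDen α (K + 1)) {k : ℕ} (hk : K ≤ k) : d k = 0 := by
  by_contra hcon
  have h1 := h.ostLow_le (k + 1)
  rw [ostLow_succ] at h1
  have h2 := shiftDen_mono hα (show K + 1 ≤ k + 1 by omega)
  have h3 : 1 * shiftDen α (k + 1) ≤ d k * shiftDen α (k + 1) :=
    Nat.mul_le_mul_right _ (Nat.one_le_iff_ne_zero.2 hcon)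
  omega

theorem lt_of_digit_eq_zero (h : IsOstrowski α d n) (hα : Irrational α) {K : ℕ}
    (hd : ∀ k, K ≤ k → d k = 0) : n < shiftDen α (K + 1) := by
  rw [h.eq_ostLow hd]
  exact h.ostLow_lt hα K

theorem digit_ne_zero_iff (h : IsOstrowski α d n) (hα : Irrational α) (K : ℕ) :
    d K ≠ 0 ↔ shiftDen α (K + 1) ≤ ostLow α d (K + 1) := by
  rw [ostLow_succ]
  constructor
  · intro hd
    have : 1 * shiftDen α (K + 1) ≤ d K * shiftDen α (K + 1) :=
      Nat.mul_le_mul_right _ (Nat.one_le_iff_ne_zero.2 hd)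
    omega
  · intro hle hd
    have := h.ostLow_lt hα K
    rw [hd] at hle
    omega

end IsOstrowski

/-- Every natural number has an Ostrowski representation. -/
theorem exists_isOstrowski {α : ℝ} (hα : Irrational α) (n : ℕ) :
    ∃ d : ℕ →₀ ℕ, IsOstrowski α d n := by
  have key : ∀ K n, n < shiftDen α (K + 1) →
      ∃ d : ℕ →₀ ℕ, IsOstrowski α d n ∧ ∀ k, K ≤ k → d k = 0 := by
    intro K
    induction K using Nat.strong_induction_on with
    | _ K ih =>
      intro n hn
      rcases K with _ | K
      · have : n = 0 := by
          simp only [shiftDen, convDen] at hn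
          omega
        subst this
        refine ⟨0, ⟨by simp, ?_, by simp, fun k _ _ => by simp⟩, by simp⟩
        simpa using one_le_partQuot_succ hα 0
      · have hQ := shiftDen_succ_pos hα K
        have hrec := shiftDen_rec α K
        set c := n / shiftDen α (K + 1) with hc
        set r := n % shiftDen α (K + 1) with hr
        have hdiv : r + c * shiftDen α (K + 1) = n := Nat.mod_add_div' n _
        have hrlt : r < shiftDen α (K + 1) := Nat.mod_lt _ hQ
        have hQle : shiftDen α K ≤ shiftDen α (K + 1) := shiftDen_mono hα (Nat.le_succ K)
        have hn' : n < partQuot α (K + 1) * shiftDen α (K + 1) + shiftDen α K := by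
          rw [← hrec]; exact hn
        have hcle : c ≤ partQuot α (K + 1) := by
          by_contra hcon
          have : (partQuot α (K + 1) + 1) * shiftDen α (K + 1) ≤ c * shiftDen α (K + 1) :=
            Nat.mul_le_mul_right _ (not_le.1 hcon)
          linarith
        -- For K = 0 the term q_{-1} = 0 drops out of the recursion, which gives the stricter bound
        -- on the first digit.
        have hc0 : K = 0 → c < partQuot α 1 := by
          rintro rfl
          simp only [shiftDen, convDen] at hn' hdiv hrlt
          simp only [zero_add] at hn'
          omega
        have hd : ∃ d : ℕ →₀ ℕ, IsOstrowski α d r ∧ (∀ k, K ≤ k → d k = 0) ∧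
            (1 ≤ K → c = partQuot α (K + 1) → d (K - 1) = 0) := by
          by_cases hcc : 1 ≤ K ∧ c = partQuot α (K + 1)
          -- A maximal quotient leaves r < q_{K-1}, so the digit at K - 1 can be taken zero.
          · obtain ⟨d, hd1, hd2⟩ := ih (K - 1) (by omega) r (by
              rw [hcc.2] at hdiv
              have : K - 1 + 1 = K := by omega
              rw [this]
              linarith)
            exact ⟨d, hd1, fun k hk => hd2 k (by omega), fun _ _ => hd2 _ le_rfl⟩
          · obtain ⟨d, hd1, hd2⟩ := ih K (by omega) r hrlt
            exact ⟨d, hd1, hd2, fun h1 h2 => absurd ⟨h1, h2⟩ hcc⟩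
        obtain ⟨d, hd1, hd2, hd3⟩ := hd
        refine ⟨d.update K c, ⟨?_, ?_, ?_, ?_⟩, ?_⟩
        · have hlow : ∀ k, K + 1 ≤ k → d.update K c k = 0 := by
            intro k hk
            rw [Finsupp.update_apply, if_neg (by omega)]
            exact hd2 k (by omega)
          rw [finsupp_sum_eq_range _ _ (by simp) hlow, Finset.sum_range_succ, ← hdiv,
            hd1.eq_ostLow hd2, ostLow]
          congr 1
          · refine Finset.sum_congr rfl fun k hk => ?_
            rw [Finsupp.update_apply, if_neg (by have := Finset.mem_range.1 hk; omega)]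
            rfl
          · rw [Finsupp.update_apply, if_pos rfl]
            rfl
        · rw [Finsupp.update_apply]
          split_ifs with h0
          · exact hc0 h0.symm
          · exact hd1.digit_zero
        · intro k hk
          rw [Finsupp.update_apply]
          split_ifs with h0
          · rw [h0]; exact hcle
          · exact hd1.digit_le k hk
        · intro k hk
          rw [Finsupp.update_apply, Finsupp.update_apply]
          split_ifs with h0 h1 h1
          · omega
          · intro hck
            subst h0
            exact hd3 hk hck
          · intro hck
            exfalso
            rw [hd2 k (by omega)] at hck
            have := one_le_partQuot_succ hα k
            omega
          · exact hd1.digit_rule k hk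
        · intro k hk
          rw [Finsupp.update_apply, if_neg (by omega)]
          exact hd2 k (by omega)
  obtain ⟨d, hd, -⟩ := key (n + 1) n (le_shiftDen_add hα n)
  exact ⟨d, hd⟩

/-! ### Ostrowski digits and the position of `n α` on the circle -/

/-- A convergent paired with an intermediate fraction; the sign (-1)^K puts the convergent below,
and r < a_{K+1} is what makes δ < ε. -/
theorem gapBasis_conv {α : ℝ} (hα : Irrational α) (hα01 : α ∈ Set.Ioo (0 : ℝ) 1) (K : ℕ) {r : ℕ}
    (hr : r < partQuot α (K + 1)) :
    GapBasis ((-1) ^ K * α) (shiftDen α (K + 1)) (shiftDen α K + r * shiftDen α (K + 1))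
      ((-1) ^ K * shiftNum α (K + 1)) ((-1) ^ K * (shiftNum α K + r * shiftNum α (K + 1)))
      (convErr α (K + 1)) (convErr α K - r * convErr α (K + 1)) := by
  have hpow : ((-1 : ℝ) ^ K) * (-1) ^ K = 1 := by rw [← mul_pow]; norm_num
  have hpowz : ((-1 : ℤ) ^ K) * (-1) ^ K = 1 := by rw [← mul_pow]; norm_num
  have h0 := shiftDen_mul_sub hα hα01 K
  have h1 := shiftDen_mul_sub hα hα01 (K + 1)
  have hdet := shiftDen_shiftNum_det α K
  rw [pow_succ] at h0 h1
  rw [pow_succ] at h1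
  refine ⟨?_, ?_, ?_, convErr_pos hα _, ?_⟩
  · push_cast
    linear_combination (-1) ^ K * h1 + convErr α (K + 1) * hpow
  · push_cast
    linear_combination (-1) ^ K * h0 + (-1) ^ K * r * h1
      + (-convErr α K + r * convErr α (K + 1)) * hpow
  · push_cast
    linear_combination (-1) ^ K * hdet + hpowz
  · have h2 : (r : ℝ) + 1 ≤ partQuot α (K + 1) := by exact_mod_cast hr
    have h3 := convErr_rec hα K
    have h4 := convErr_pos hα (K + 1)
    have h5 := convErr_pos hα (K + 2)
    nlinarith

theorem conv_coords {α : ℝ} (hα : Irrational α) (hα01 : α ∈ Set.Ioo (0 : ℝ) 1) (K : ℕ)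
    (k l : ℤ) : ∃ x y : ℤ, k = x * shiftDen α (K + 1) + y * shiftDen α K ∧
      (-1) ^ K * ((k : ℝ) * α - l) = x * convErr α (K + 1) - y * convErr α K := by
  obtain ⟨x, y, h1, h2⟩ :=
    (gapBasis_conv hα hα01 K (one_le_partQuot_succ hα K)).coords k ((-1) ^ K * l)
  refine ⟨x, y, by simpa using h1, ?_⟩
  push_cast at h2
  linear_combination h2

/-- Convergents are best approximations. -/
theorem convErr_le_abs {α : ℝ} (hα : Irrational α) (hα01 : α ∈ Set.Ioo (0 : ℝ) 1) {K k : ℕ}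
    (hk0 : 1 ≤ k) (hk : k < shiftDen α (K + 2)) (l : ℤ) :
    convErr α (K + 1) ≤ |(k : ℝ) * α - l| := by
  obtain ⟨x, y, h1, h2⟩ := conv_coords hα hα01 (K + 1) k l
  have habs : |(k : ℝ) * α - l| = |(x : ℝ) * convErr α (K + 2) - y * convErr α (K + 1)| := by
    rw [← h2, abs_mul, abs_pow, abs_neg, abs_one, one_pow, one_mul, Int.cast_natCast]
  rw [habs]
  have hp1 := convErr_pos hα (K + 1)
  have hp2 := convErr_pos hα (K + 2)
  have hq1 : (1 : ℤ) ≤ shiftDen α (K + 1) := by exact_mod_cast shiftDen_succ_pos hα K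
  have hk' : (k : ℤ) < shiftDen α (K + 1 + 1) := by exact_mod_cast hk
  have hk0' : (1 : ℤ) ≤ k := by exact_mod_cast hk0
  rcases lt_trichotomy x 0 with hx | hx | hx
  · have hy : 1 ≤ y := by
      by_contra hcon
      nlinarith
    have hxr : (x : ℝ) ≤ 0 := by exact_mod_cast hx.le
    have hyr : (1 : ℝ) ≤ y := by exact_mod_cast hy
    rw [abs_of_nonpos] <;> nlinarith
  · subst hx
    have hy : 1 ≤ y := by
      by_contra hcon
      nlinarith
    have hyr : (1 : ℝ) ≤ y := by exact_mod_cast hy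
    push_cast
    rw [abs_of_nonpos] <;> nlinarith
  · have hy : y ≤ -1 := by
      by_contra hcon
      nlinarith
    have hxr : (0 : ℝ) ≤ x := by exact_mod_cast hx.le
    have hyr : (y : ℝ) ≤ -1 := by exact_mod_cast hy
    rw [abs_of_nonneg] <;> nlinarith

namespace IsOstrowski

variable {α : ℝ} {d : ℕ →₀ ℕ} {n : ℕ}

/-- The digits of an integer `n` for which `n α` is close to an integer. -/
theorem digits_of_abs_lt (h : IsOstrowski α d n) (hα : Irrational α)
    (hα01 : α ∈ Set.Ioo (0 : ℝ) 1) {K : ℕ} {l : ℤ}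
    (hl : |(n : ℝ) * α - l| < convErr α (K + 1)) :
    (∀ k, k ≤ K → d k = 0) ∨
      ((∀ k, k < K → d k = 0) ∧ d K = 1 ∧ 0 < ostTail α d (K + 1)) := by
  obtain ⟨l₁, hl₁⟩ := h.exists_int_eq hα hα01 (K + 1)
  obtain ⟨hτ1, hτ2⟩ := h.ostTail_bounds hα (K + 1)
  have hlow := h.ostLow_lt hα (K + 1)
  -- A nonzero low part is x q_{K+1} + y q_K, lies below q_{K+1}, and nearly cancels against the
  -- tail; this leaves only x = 0, y = 1.
  obtain ⟨x, y, h1, h2⟩ := conv_coords hα hα01 (K + 1) (ostLow α d (K + 1)) (l - l₁)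
  have hpow : ((-1 : ℝ) ^ (K + 1)) * (-1) ^ (K + 1) = 1 := by rw [← mul_pow]; norm_num
  set s : ℝ := (-1) ^ (K + 1) with hs
  set τ := ostTail α d (K + 1) with hτ
  have hw : |s * ((n : ℝ) * α - l)| < convErr α (K + 1) := by
    rw [abs_mul, hs, abs_pow, abs_neg, abs_one, one_pow, one_mul]
    exact hl
  rw [abs_lt] at hw
  have hval : s * ((n : ℝ) * α - l) - τ = x * convErr α (K + 2) - y * convErr α (K + 1) := by
    rw [← h2]
    push_cast
    linear_combination s * hl₁ + τ * hpow
  have hp1 := convErr_pos hα (K + 1)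
  have hp2 := convErr_pos hα (K + 2)
  have hq1 : (1 : ℤ) ≤ shiftDen α (K + 1) := by exact_mod_cast shiftDen_succ_pos hα K
  have hq2 : (shiftDen α (K + 1) : ℤ) ≤ shiftDen α (K + 1 + 1) := by
    exact_mod_cast shiftDen_mono hα (Nat.le_succ (K + 1))
  have hlow' : (ostLow α d (K + 1) : ℤ) < shiftDen α (K + 1 + 1) := by exact_mod_cast hlow
  rcases Nat.eq_zero_or_pos (ostLow α d (K + 1)) with h0 | h0
  · left
    intro k hk
    exact (ostLow_eq_zero_iff hα d (K + 1)).1 h0 k (by omega)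
  · right
    have h0' : (1 : ℤ) ≤ ostLow α d (K + 1) := by exact_mod_cast h0
    have e2 : convErr α (K + 1 + 1) = convErr α (K + 2) := rfl
    have hx : x = 0 := by
      rcases lt_trichotomy x 0 with hx | hx | hx
      · exfalso
        have hy : 2 ≤ y := by
          by_contra hcon
          nlinarith
        have hxr : (x : ℝ) ≤ 0 := by exact_mod_cast hx.le
        have hyr : (2 : ℝ) ≤ y := by exact_mod_cast hy
        nlinarith
      · exact hx
      · exfalso
        have hy : y ≤ -1 := by
          by_contra hcon
          nlinarith
        have hxr : (1 : ℝ) ≤ x := by exact_mod_cast hx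
        have hyr : (y : ℝ) ≤ -1 := by exact_mod_cast hy
        nlinarith
    subst hx
    have hy0 : 1 ≤ y := by
      by_contra hcon
      nlinarith
    have hy1 : y = 1 := by
      by_contra hcon
      have hyr : (2 : ℝ) ≤ y := by exact_mod_cast (by omega : 2 ≤ y)
      push_cast at hval
      nlinarith
    subst hy1
    have hlowK : ostLow α d (K + 1) = shiftDen α (K + 1) := by
      have : (ostLow α d (K + 1) : ℤ) = shiftDen α (K + 1) := by linarith
      exact_mod_cast this
    rw [ostLow_succ] at hlowK
    have hlt := h.ostLow_lt hα K
    have hdK : d K = 1 := by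
      have hne : d K ≠ 0 := by
        intro hd
        rw [hd] at hlowK
        omega
      by_contra hcon
      have : 2 * shiftDen α (K + 1) ≤ d K * shiftDen α (K + 1) :=
        Nat.mul_le_mul_right _ (by omega)
      omega
    rw [hdK] at hlowK
    refine ⟨(ostLow_eq_zero_iff hα d K).1 (by omega), hdK, ?_⟩
    push_cast at hval
    linarith

theorem exists_abs_lt (h : IsOstrowski α d n) (hα : Irrational α)
    (hα01 : α ∈ Set.Ioo (0 : ℝ) 1) {K : ℕ}
    (hd : (∀ k, k ≤ K → d k = 0) ∨
      ((∀ k, k < K → d k = 0) ∧ d K = 1 ∧ 0 < ostTail α d (K + 1))) :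
    ∃ l : ℤ, |(n : ℝ) * α - l| < convErr α (K + 1) := by
  rcases hd with hd | ⟨hd, hd1, hpos⟩
  · obtain ⟨l, hl⟩ := h.exists_int_eq hα hα01 (K + 1)
    refine ⟨l, ?_⟩
    rw [hl, (ostLow_eq_zero_iff hα d (K + 1)).2 fun k hk => hd k (by omega), Nat.cast_zero,
      zero_mul, zero_add, abs_mul, abs_pow, abs_neg, abs_one, one_pow, one_mul, abs_lt]
    obtain ⟨h1, h2⟩ := h.ostTail_bounds hα (K + 1)
    exact ⟨by linarith [convErr_succ_lt hα (K + 1)], h2⟩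
  · obtain ⟨l, hl⟩ := h.exists_int_eq hα hα01 K
    refine ⟨l, ?_⟩
    rw [hl, (ostLow_eq_zero_iff hα d K).2 hd, Nat.cast_zero,
      zero_mul, zero_add, abs_mul, abs_pow, abs_neg, abs_one, one_pow, one_mul, ostTail_rec, hd1,
      abs_lt]
    obtain ⟨h1, h2⟩ := h.ostTail_bounds hα (K + 1)
    push_cast
    constructor <;> linarith

/-- The splitting of an Ostrowski representation is determined by the position of `n α`. -/
theorem ostLow_ostTail_eq (h : IsOstrowski α d n) (hα : Irrational α)
    (hα01 : α ∈ Set.Ioo (0 : ℝ) 1) {N n₀ : ℕ} {l : ℤ} {z : ℝ}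
    (hn : (n : ℝ) * α - l = n₀ * α + (-1) ^ N * z) (hn₀ : n₀ < shiftDen α (N + 1))
    (hz0 : 0 < z) (hz : z < convErr α N)
    (hz' : shiftDen α N ≤ n₀ → z < convErr α N - convErr α (N + 1)) :
    ostLow α d N = n₀ ∧ ostTail α d N = z := by
  obtain ⟨l₁, hl₁⟩ := h.exists_int_eq hα hα01 N
  obtain ⟨hτ1, hτ2⟩ := h.ostTail_bounds hα N
  have hlow := h.ostLow_lt hα N
  -- The two splittings differ by a lattice vector that the size bounds force to vanish; the
  -- borderline case x = 0, y = 1 is what `hz'` excludes.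
  obtain ⟨x, y, h1, h2⟩ := conv_coords hα hα01 N (n₀ - ostLow α d N) (l₁ - l)
  have hpow : ((-1 : ℝ) ^ N) * (-1) ^ N = 1 := by rw [← mul_pow]; norm_num
  set τ := ostTail α d N with hτ
  have hval : τ - z = x * convErr α (N + 1) - y * convErr α N := by
    rw [← h2]
    push_cast
    linear_combination (-1) ^ N * (hn - hl₁) + (z - τ) * hpow
  have hp0 := convErr_pos hα N
  have hp1 := convErr_pos hα (N + 1)
  have hp2 := convErr_succ_lt hα N
  have hq0 : (0 : ℤ) ≤ shiftDen α N := Int.natCast_nonneg _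
  have hq1 : (1 : ℤ) ≤ shiftDen α (N + 1) := by exact_mod_cast shiftDen_succ_pos hα N
  have hlow' : (ostLow α d N : ℤ) < shiftDen α (N + 1) := by exact_mod_cast hlow
  have hn₀' : (n₀ : ℤ) < shiftDen α (N + 1) := by exact_mod_cast hn₀
  have hlow0 : (0 : ℤ) ≤ ostLow α d N := Int.natCast_nonneg _
  have hn₀0 : (0 : ℤ) ≤ n₀ := Int.natCast_nonneg _
  have hy : y = 0 := by
    rcases lt_trichotomy y 0 with hy | hy | hy
    · exfalso
      have hx : 0 ≤ x := by
        by_contra hcon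
        nlinarith
      have hxr : (0 : ℝ) ≤ x := by exact_mod_cast hx
      have hyr : (y : ℝ) ≤ -1 := by exact_mod_cast (by omega : y ≤ -1)
      nlinarith
    · exact hy
    · exfalso
      have hx : x ≤ 0 := by
        by_contra hcon
        nlinarith
      have hyr : (1 : ℝ) ≤ y := by exact_mod_cast hy
      rcases hx.lt_or_eq with hx | rfl
      · have hxr : (x : ℝ) ≤ -1 := by exact_mod_cast (by omega : x ≤ -1)
        nlinarith
      · rcases (by omega : y = 1 ∨ 2 ≤ y) with rfl | hy2
        · have h3 : shiftDen α N ≤ n₀ := by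
            have : (shiftDen α N : ℤ) ≤ n₀ := by linarith
            exact_mod_cast this
          have := hz' h3
          push_cast at hval
          linarith
        · have hyr : (2 : ℝ) ≤ y := by exact_mod_cast hy2
          push_cast at hval
          nlinarith
  subst hy
  have hx : x = 0 := by
    rcases lt_trichotomy x 0 with hx | hx | hx
    · exfalso
      nlinarith
    · exact hx
    · exfalso
      nlinarith
  subst hx
  push_cast at hval
  constructor
  · have : (ostLow α d N : ℤ) = n₀ := by linarith
    exact_mod_cast this
  · linarith

end IsOstrowski

theorem irrational_neg_one_pow_mul {α : ℝ} (hα : Irrational α) (k : ℕ) :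
    Irrational ((-1) ^ k * α) := by
  rcases neg_one_pow_eq_or ℝ k with h | h <;> rw [h]
  · rwa [one_mul]
  · rw [neg_one_mul]
    exact hα.neg

/-! ### The characterization of balanced rectangles -/

/-- If the `m × n` rectangles are balanced and `q M < m ≤ q (M + 1)`, then `n α` lies near an
integer or, for special `m`, near one of the points `n₀ α`. -/
theorem PhaseBalanced.position {α : ℝ} (hα : Irrational α) (hα01 : α ∈ Set.Ioo (0 : ℝ) 1)
    {m n M : ℕ} (hmn : m ≤ n) (hm1 : shiftDen α (M + 1) < m) (hm2 : m ≤ shiftDen α (M + 2))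
    (hb : PhaseBalanced α m n) :
    (∃ l : ℤ, |(n : ℝ) * α - l| < convErr α (M + 1)) ∨
      ∃ r < partQuot α (M + 1), m = shiftDen α M + (r + 1) * shiftDen α (M + 1) ∧
        ∃ (n₀ : ℕ) (l : ℤ) (z : ℝ), (n : ℝ) * α - l = n₀ * α + (-1) ^ (M + 1) * z ∧
          0 < z ∧ z < convErr α (M + 1) ∧ n₀ < m ∧ (shiftDen α (M + 1) ≤ n₀ →
            z < convErr α (M + 1) - (convErr α M - (r + 1) * convErr α (M + 1))) := by
  have hQ1 := shiftDen_succ_pos hα M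
  have hQ0 : shiftDen α M ≤ shiftDen α (M + 1) := shiftDen_mono hα (Nat.le_succ M)
  obtain ⟨r, hr1, hr2⟩ : ∃ r, shiftDen α M + r * shiftDen α (M + 1) < m ∧
      m ≤ shiftDen α M + (r + 1) * shiftDen α (M + 1) := by
    refine ⟨(m - 1 - shiftDen α M) / shiftDen α (M + 1), ?_, ?_⟩
    · have := Nat.div_mul_le_self (m - 1 - shiftDen α M) (shiftDen α (M + 1))
      omega
    · have := Nat.lt_div_mul_add (a := m - 1 - shiftDen α M) hQ1
      rw [add_mul]
      omega
  have hra : r < partQuot α (M + 1) := by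
    rw [shiftDen_rec] at hm2
    by_contra hcon
    have : partQuot α (M + 1) * shiftDen α (M + 1) ≤ r * shiftDen α (M + 1) :=
      Nat.mul_le_mul_right _ (not_lt.1 hcon)
    omega
  have hv : 1 ≤ shiftDen α M + r * shiftDen α (M + 1) := by
    rw [add_mul] at hr2
    omega
  have H := gapBasis_conv hα hα01 M hra
  have hpow : ((-1 : ℝ) ^ M) * (-1) ^ M = 1 := by rw [← mul_pow]; norm_num
  rcases H.of_phaseBalanced (irrational_neg_one_pow_mul hα M) hQ1 hm1 hv hr1
    (by rw [add_mul] at hr2; omega) hmn ((phaseBalanced_neg_one_pow_mul α m n M).2 hb) with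
    ⟨l, hl⟩ | ⟨huv, n₀, l, z, hn, hz0, hz, hn₀, hz'⟩
  · left
    refine ⟨(-1) ^ M * l, ?_⟩
    have h1 : (n : ℝ) * α - ((-1) ^ M * l : ℤ) = (-1) ^ M * (n * ((-1) ^ M * α) - l) := by
      push_cast
      linear_combination (-(n : ℝ) * α) * hpow
    rw [h1, abs_mul, abs_pow, abs_neg, abs_one, one_pow, one_mul]
    exact hl
  · right
    refine ⟨r, hra, ?_, n₀, (-1) ^ M * l, z, ?_, hz0, hz, hn₀, fun h => ?_⟩
    · rw [← huv]; ring
    · push_cast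
      rw [pow_succ]
      linear_combination (-1) ^ M * hn + ((n₀ : ℝ) * α - n * α) * hpow
    · have := hz' h
      linarith

/-- Balance from the position of `n α` when `m = q (M - 1) + (r + 1) q M`. -/
theorem phaseBalanced_of_position {α : ℝ} (hα : Irrational α) (hα01 : α ∈ Set.Ioo (0 : ℝ) 1)
    {n M r n₀ : ℕ} {l : ℤ} {z : ℝ} (hr : r < partQuot α (M + 1))
    (hn : (n : ℝ) * α - l = n₀ * α + (-1) ^ (M + 1) * z)
    (hz0 : 0 < z) (hz : z < convErr α (M + 1))
    (hn₀ : n₀ < shiftDen α M + (r + 1) * shiftDen α (M + 1))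
    (hz' : shiftDen α (M + 1) ≤ n₀ →
      z < convErr α (M + 1) - (convErr α M - (r + 1) * convErr α (M + 1))) :
    PhaseBalanced α (shiftDen α M + (r + 1) * shiftDen α (M + 1)) n := by
  have hpow : ((-1 : ℝ) ^ M) * (-1) ^ M = 1 := by rw [← mul_pow]; norm_num
  have hm : shiftDen α M + (r + 1) * shiftDen α (M + 1)
      = shiftDen α (M + 1) + (shiftDen α M + r * shiftDen α (M + 1)) := by ring
  have hQ1 := shiftDen_succ_pos hα M
  rw [hm] at hn₀ ⊢
  rw [← phaseBalanced_neg_one_pow_mul α _ n M]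
  refine (gapBasis_conv hα hα01 M hr).phaseBalanced (irrational_neg_one_pow_mul hα M) (by omega)
    ((-1) ^ M * l) (z := z) ?_ hz0 hz hn₀ fun h => ?_
  · push_cast
    rw [pow_succ] at hn
    linear_combination (-1) ^ M * hn - z * hpow
  · have := hz' h
    linarith

theorem phaseBalanced_of_abs_lt {α : ℝ} (hα : Irrational α) (hα01 : α ∈ Set.Ioo (0 : ℝ) 1)
    {m n M : ℕ} (hm : 1 ≤ m) (hmM : m ≤ shiftDen α (M + 2)) {l : ℤ}
    (hl : |(n : ℝ) * α - l| < convErr α (M + 1)) : PhaseBalanced α m n :=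
  phaseBalanced_of_dist_lt hα hm l fun _ hk0 hk c =>
    hl.trans_le (convErr_le_abs hα hα01 hk0 (hk.trans_le hmM) c)

theorem exists_shiftDen_lt_le {α : ℝ} (hα : Irrational α) {m : ℕ} (hm : 2 ≤ m) :
    ∃ M, shiftDen α (M + 1) < m ∧ m ≤ shiftDen α (M + 2) := by
  have hex : ∃ K, m ≤ shiftDen α (K + 1) :=
    ⟨m + 1, (Nat.le_succ m).trans (le_shiftDen_add hα m)⟩
  classical
  rcases hK : Nat.find hex with _ | M
  · have := Nat.find_spec hex
    rw [hK] at this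
    simp only [shiftDen, convDen] at this
    omega
  · refine ⟨M, ?_, ?_⟩
    · have := Nat.find_min hex (m := M) (by omega)
      omega
    · have := Nat.find_spec hex
      rwa [hK] at this

theorem theorem2p1 (α : ℝ) (hα : Irrational α) (hα01 : α ∈ Set.Ioo (0 : ℝ) 1)
    (θ : ℝ) (hθ : θ ∈ Set.Ico (0 : ℝ) 1) (m n : ℕ) (hm : 2 ≤ m) (hmn : m ≤ n) :
    BalancedRectangles (sturmianWord α θ) m n ↔
      ∃ b d : ℕ →₀ ℕ, IsOstrowski α b m ∧ IsOstrowski α d n ∧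
        ((∃ M : ℕ, (∀ k, M < k → b k = 0) ∧ (∀ k, k ≤ M → d k = 0)) ∨
          (∃ M t : ℕ, (∀ k, M < k → b k = 0) ∧ b M ≠ 0 ∧
            (∀ k, k < M → d k = 0) ∧ d M = 1 ∧
            (∀ k, M < k → k < M + 1 + 2 * t → d k = 0) ∧ d (M + 1 + 2 * t) ≠ 0) ∨
          (∃ M t : ℕ, m = convDen α M ∧
            (∀ k, M ≤ k → k < M + 2 * t → d k = 0) ∧ d (M + 2 * t) ≠ 0) ∨
          (∃ M a t : ℕ, 1 ≤ M ∧ 1 ≤ a ∧ a < partQuot α (M + 1) ∧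
            m = convDen α (M - 1) + a * convDen α M ∧
            (∀ k, M ≤ k → k < M + 1 + 2 * t → d k = 0) ∧ d (M + 1 + 2 * t) ≠ 0)) := by
  rw [balancedRectangles_iff hα hα01]
  constructor
  · intro hbal
    obtain ⟨b, hb⟩ := exists_isOstrowski hα m
    obtain ⟨d, hd⟩ := exists_isOstrowski hα n
    refine ⟨b, d, hb, hd, ?_⟩
    obtain ⟨M, hm1, hm2⟩ := exists_shiftDen_lt_le hα hm
    have hQ1 := shiftDen_succ_pos hα M
    have hrec := shiftDen_rec α M
    have hpos := hbal.position hα hα01 hmn hm1 hm2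
    rcases hm2.lt_or_eq with hlt | heq
    · have hb0 : ∀ k, M < k → b k = 0 := fun k hk => hb.digit_eq_zero_of_lt hα hlt hk
      have hbM : b M ≠ 0 := by
        rw [hb.digit_ne_zero_iff hα, ← hb.eq_ostLow fun k hk => hb0 k hk]
        exact hm1.le
      have near : (∃ l : ℤ, |(n : ℝ) * α - l| < convErr α (M + 1)) →
          (∃ M : ℕ, (∀ k, M < k → b k = 0) ∧ (∀ k, k ≤ M → d k = 0)) ∨
          (∃ M t : ℕ, (∀ k, M < k → b k = 0) ∧ b M ≠ 0 ∧
            (∀ k, k < M → d k = 0) ∧ d M = 1 ∧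
            (∀ k, M < k → k < M + 1 + 2 * t → d k = 0) ∧ d (M + 1 + 2 * t) ≠ 0) := by
        rintro ⟨l, hl⟩
        rcases hd.digits_of_abs_lt hα hα01 hl with h0 | ⟨h0, h1, h2⟩
        · exact Or.inl ⟨M, hb0, h0⟩
        · obtain ⟨t, ht1, ht2⟩ := (hd.ostTail_pos_iff hα (M + 1)).1 h2
          exact Or.inr ⟨M, t, hb0, hbM, h0, h1, ht1, ht2⟩
      rcases hpos with hnear | ⟨r, hr, hmr, n₀, l, z, hn, hz0, hz, hn₀, hz'⟩
      · exact (near hnear).elim Or.inl fun h => Or.inr (Or.inl h)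
      · have hra : r + 1 < partQuot α (M + 1) := by
          by_contra hcon
          have : r + 1 = partQuot α (M + 1) := by omega
          rw [this] at hmr
          omega
        -- For r + 1 < a_{M+1} the bound on z in `hz'` is negative.
        have hn₀' : n₀ < shiftDen α (M + 1) := by
          by_contra hcon
          have h1 := hz' (not_lt.1 hcon)
          have h2 := convErr_rec hα M
          have h3 : (r : ℝ) + 1 + 1 ≤ partQuot α (M + 1) := by exact_mod_cast hra
          have h4 := convErr_pos hα (M + 1)
          have h5 := convErr_pos hα (M + 2)
          nlinarith
        -- Case (iv) needs M ≥ 1. For M = 0, q_0 = 1 forces n₀ = 0, so nα is close to an integer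
        -- after all.
        rcases Nat.eq_zero_or_pos M with rfl | hM
        · have h0 : n₀ = 0 := by
            simp only [shiftDen, convDen] at hn₀'
            omega
          refine (near ⟨l, ?_⟩).elim Or.inl fun h => Or.inr (Or.inl h)
          rw [hn, h0, Nat.cast_zero, zero_mul, zero_add, abs_mul, abs_pow, abs_neg, abs_one,
            one_pow, one_mul, abs_of_pos hz0]
          exact hz
        · obtain ⟨hlow, htail⟩ := hd.ostLow_ostTail_eq hα hα01 hn (hn₀.trans_le hm2) hz0 hz
            fun h => absurd h (not_le.2 hn₀')
          have hdM : d M = 0 := by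
            by_contra hcon
            rw [← ne_eq, hd.digit_ne_zero_iff hα, hlow] at hcon
            omega
          obtain ⟨t, ht1, ht2⟩ := (hd.ostTail_pos_iff hα (M + 1)).1 (htail ▸ hz0)
          refine Or.inr (Or.inr (Or.inr ⟨M, r + 1, t, hM, by omega, hra, ?_, ?_, ht2⟩))
          · obtain ⟨M, rfl⟩ : ∃ M', M = M' + 1 := ⟨M - 1, by omega⟩
            exact hmr
          · intro k hk1 hk2
            rcases hk1.eq_or_lt with rfl | hk1
            · exact hdM
            · exact ht1 k hk1 hk2
    · have third : 0 < ostTail α d (M + 1) → ∃ M t : ℕ, m = convDen α M ∧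
            (∀ k, M ≤ k → k < M + 2 * t → d k = 0) ∧ d (M + 2 * t) ≠ 0 := by
        intro h
        obtain ⟨t, ht1, ht2⟩ := (hd.ostTail_pos_iff hα (M + 1)).1 h
        exact ⟨M + 1, t, heq, ht1, ht2⟩
      rcases hpos with ⟨l, hl⟩ | ⟨r, hr, hmr, n₀, l, z, hn, hz0, hz, hn₀, hz'⟩
      · rcases hd.digits_of_abs_lt hα hα01 hl with h0 | ⟨-, -, h2⟩
        -- For m = q_{M+1}, a positive tail gives (iii); otherwise the digit at M + 1 vanishes too,
        -- and (i) holds with M + 1.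
        · by_cases hpos : 0 < ostTail α d (M + 1)
          · exact Or.inr (Or.inr (Or.inl (third hpos)))
          · left
            refine ⟨M + 1, fun k hk => ?_, fun k hk => ?_⟩
            · have := shiftDen_add_le hα (M + 1)
              exact hb.digit_eq_zero_of_lt hα (K := M + 2) (by
                have e : shiftDen α (M + 1 + 1) = shiftDen α (M + 2) := rfl
                have e' : shiftDen α (M + 1 + 2) = shiftDen α (M + 2 + 1) := rfl
                omega) hk
            · rcases (by omega : k ≤ M ∨ k = M + 1) with hk | rfl
              · exact h0 k hk
              · by_contra hcon
                exact hpos (hd.ostTail_pos hα hcon)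
        · exact Or.inr (Or.inr (Or.inl (third h2)))
      · have hra : r + 1 = partQuot α (M + 1) := by
          have : (r + 1) * shiftDen α (M + 1) = partQuot α (M + 1) * shiftDen α (M + 1) := by
            omega
          exact Nat.eq_of_mul_eq_mul_right hQ1 this
        obtain ⟨-, htail⟩ := hd.ostLow_ostTail_eq hα hα01 hn (heq ▸ hn₀) hz0 hz fun h => by
          have h1 := hz' h
          have h2 := convErr_rec hα M
          have h3 : (r : ℝ) + 1 = partQuot α (M + 1) := by exact_mod_cast hra
          rw [h3] at h1
          have e : convErr α (M + 1 + 1) = convErr α (M + 2) := rfl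
          linarith
        exact Or.inr (Or.inr (Or.inl (third (htail ▸ hz0))))
  · rintro ⟨b, d, hb, hd, ⟨M, hb0, hd0⟩ | ⟨M, t, hb0, -, hd0, hd1, ht1, ht2⟩ |
      ⟨M, t, hmM, ht1, ht2⟩ | ⟨M, a, t, hM, ha1, ha, hma, ht1, ht2⟩⟩
    · obtain ⟨l, hl⟩ := hd.exists_abs_lt hα hα01 (Or.inl hd0)
      exact phaseBalanced_of_abs_lt hα hα01 (by omega)
        (hb.lt_of_digit_eq_zero hα (K := M + 1) hb0).le hl
    · obtain ⟨l, hl⟩ := hd.exists_abs_lt hα hα01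
        (Or.inr ⟨hd0, hd1, (hd.ostTail_pos_iff hα (M + 1)).2 ⟨t, ht1, ht2⟩⟩)
      exact phaseBalanced_of_abs_lt hα hα01 (by omega)
        (hb.lt_of_digit_eq_zero hα (K := M + 1) hb0).le hl
    · rcases M with _ | M
      · simp only [convDen] at hmM
        omega
      have hrec := shiftDen_rec α M
      obtain ⟨r, hr⟩ : ∃ r, partQuot α (M + 1) = r + 1 :=
        ⟨partQuot α (M + 1) - 1, by have := one_le_partQuot_succ hα M; omega⟩
      have hm' : m = shiftDen α M + (r + 1) * shiftDen α (M + 1) := by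
        rw [← hr, add_comm, ← hrec, hmM]
        rfl
      obtain ⟨l, hl⟩ := hd.exists_int_eq hα hα01 (M + 1)
      rw [hm']
      refine phaseBalanced_of_position hα hα01 (by omega) hl
        ((hd.ostTail_pos_iff hα (M + 1)).2 ⟨t, ht1, ht2⟩) (hd.ostTail_bounds hα (M + 1)).2 ?_ ?_
      · rw [← hm', hmM]
        exact hd.ostLow_lt hα (M + 1)
      · intro h
        rw [← hd.digit_ne_zero_iff hα] at h
        -- A low part of at least q_M means d_M ≠ 0, so the digit rule keeps d_{M+1} below its
        -- maximum; this supplies the extra bound on z.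
        have h1 := hd.ostTail_lt hα (K := M + 1) (lt_of_le_of_ne (hd.digit_le' (M + 1))
          fun hcon => h (hd.digit_rule (M + 1) (by omega) hcon))
        have h2 := convErr_rec hα M
        rw [hr] at h2
        push_cast at h2
        have e : convErr α (M + 1 + 1) = convErr α (M + 2) := rfl
        linarith
    · obtain ⟨r, rfl⟩ : ∃ r, a = r + 1 := ⟨a - 1, by omega⟩
      have hm' : m = shiftDen α M + (r + 1) * shiftDen α (M + 1) := by
        obtain ⟨M, rfl⟩ : ∃ M', M = M' + 1 := ⟨M - 1, by omega⟩
        exact hma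
      have hlow : ostLow α d (M + 1) < shiftDen α (M + 1) := by
        have h1 := hd.digit_ne_zero_iff hα M
        have h2 := ht1 M le_rfl (by omega)
        by_contra hcon
        exact h1.2 (not_lt.1 hcon) h2
      obtain ⟨l, hl⟩ := hd.exists_int_eq hα hα01 (M + 1)
      rw [hm']
      refine phaseBalanced_of_position hα hα01 (by omega) hl
        ((hd.ostTail_pos_iff hα (M + 1)).2 ⟨t, fun k hk1 hk2 => ht1 k (by omega) hk2, ht2⟩)
        (hd.ostTail_bounds hα (M + 1)).2 ?_ fun h => absurd h (not_le.2 hlow)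
      rw [add_mul]
      omega
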